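/- **Patterns.** A pattern $\mathfrak P$ on a finite, totally ordered set $Q$ of qubits is a finite sequence of the commands $N_i$ (prepare qubit $i$ in $|+\rangle$), $E_{ij}$ with $i\ne j$ (apply $\wedge Z$), $M_i^\alpha$ (destructive measurement of qubit $i$ in the basis $|\pm_\alpha\rangle=\frac1{\sqrt2}(|0\rangle\pm e^{i\alpha}|1\rangle)$, with outcome stored in the signal $s_i\in\{0,1\}$), $X_i, Z_i$ (Pauli corrections) and $X_i^{s}, Z_i^{s}$ (corrections applied iff the signal $s$ is $1$), such that the preparation of a qubit is the first command acting on it, its measurement is the last command acting on it, and a correction is controlled only by the signal of a measurement performed before. (A conditional measurement ${}^s[M_i^\alpha]^t$ abbreviates $M_i^\alpha Z_i^tX_i^s$.) Qubits that are not prepared are inputs, qubits that are not measured are outputs. For each assignment $v$ of outcomes to the measurements, the *branch map* $\mathfrak P_v$ is the linear map from the input register to the output register obtained by executing the commands, a measurement of qubit $i$ acting by $\langle +_\alpha|$ if $v(i)=0$ and by $\langle -_\alpha|$ if $v(i)=1$. The pattern is *strongly deterministic* if all its branch maps coincide up to a global phase: for all $v,w$ there is $z\in\mathbb C$ with $|z|=1$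 and $\mathfrak P_v=z\,\mathfrak P_w$. **Conditional diagrams.** A conditional diagram is a finite open (multi)graph with totally ordered inputs and outputs of degree one, whose interior vertices are Hadamard vertices of degree 2 and $Z$ or $X$ spiders of any degree with a label $(\alpha,U)$, where $\alpha\in\mathbb R/2\pi\mathbb Z$, $U$ is a finite set of variables, and $U=\emptyset$ if $\alpha=0$. It is *unconditional* if all the sets $U$ are empty. Under a valuation $v$ of the variables in $\{0,1\}$, a vertex $(\alpha,U)$ gets the angle $\alpha$ if $U=\emptyset$ or $\sum_{s\in U}v(s)\neq0$ (then $U$ is *active*), and the angle $0$ otherwise. A $Z$ spider of angle $\alpha$ denotes $|0\cdots0\rangle\langle0\cdots0|+e^{i\alpha}|1\cdots1\rangle\langle1\cdots1|$, an $X$ spider the same in the basis $|\pm\rangle$, and a Hadamard vertex the Hadamard matrix. $D(\mathfrak P)$ is the diagram, with signals as variables, composed of these pieces: a $Z$ vertex of degree one for $N_i$; for $E_{ij}$ an unlabelled $Z$ vertex on each of the wires $i$, $j$, joined through a Hadamard vertex; for $M_i^\alpha$ a $Z$ vertex $(\pi,\{s_i\})$ on wire $i$ followed by a final $Z$ vertex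 $-\alpha$; for $X_i^s$ and $Z_i^s$ an $X$, respectively $Z$, vertex $(\pi,\{s\})$ on wire $i$ (and $(\pi,\emptyset)$ for $X_i$, $Z_i$). **Rewriting.** Labelled-isomorphic diagrams are identified, and a diagram is rewritten by replacing subdiagrams, any finite number of times, by the following rules, used in both directions, and the rules with the colours exchanged: * spider: adjacent $Z$ vertices $(\alpha,U)$, $(\beta,V)$, joined by one or more wires, merge to a $Z$ vertex $(\gamma,W)$ if the angles add up in every valuation; * anti-loop: a self-loop at a spider is removed; * identity: an unlabelled spider of degree 2 becomes a wire; * $\alpha$-commute: two adjacent $Z$ vertices exchange their labels; * copying: an unlabelled $X$ vertex of degree one attached to an unlabelled $Z$ vertex is copied to the other legs of the latter; * $\pi$-commute: an $X$ vertex $(\pi,U)$ of degree two attached to a $Z$ vertex moves through it to all its other legs, the label of the $Z$ vertex becoming one whose angle is negated exactly in the valuations in which $U$ is active; * bialgebra: two unlabelled $Z$ vertices and two unlabelled $X$ vertices, each of degree three and joined in a complete bipartite way, become one $X$ vertex, attached to the open legs of the former $Z$ vertices, joined to one $Z$ vertex, attached to the open legs of the former $X$ vertices; * Hopf: two parallel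 wires between a $Z$ and an $X$ vertex are removed; * $H$-commute: a $Z$ vertex with a Hadamard vertex on each leg becomes the $X$ vertex with the same label; * $H$-cancel: two consecutive Hadamard vertices become a wire; * scalars: a subdiagram without open wires is dropped if its value is non-zero and has the same modulus in every valuation. (A rewrite is made only if the result is again a graph of this kind, without vertex-free closed loops.) **Theorem.** If the conditional diagram $D(\mathfrak P)$ of a pattern $\mathfrak P$ can be rewritten to an unconditional diagram, then $\mathfrak P$ is strongly deterministic. -/

import Mathlib

namespace MBQC

universe u

/-! ### Conditional diagrams -/

/-- The two colours of spiders: `Z` (green) and `X` (red). -/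
inductive Colour
  | Z
  | X

/-- The opposite colour. -/
def Colour.swap : Colour → Colour
  | Z => X
  | X => Z

/-- An interior vertex of a diagram. Edges ("wires") are named by natural numbers, and a vertex
carries the multiset of the wires that end at it (a self-loop occurs twice). A spider has a colour,
an angle in `ℝ / 2πℤ`, and a finite set `U` of variables (`U = ∅`: the vertex is unconditional). -/
inductive Vertex (𝒱 : Type u)
  | spider (c : Colour) (α : Real.Angle) (U : Finset 𝒱) (legs : Multiset ℕ)
  | hadamard (legs : Multiset ℕ)

namespace Vertex

variable {𝒱 : Type u}

/-- The wires ending at a vertex. -/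
def legs : Vertex 𝒱 → Multiset ℕ
  | spider _ _ _ A => A
  | hadamard A => A

/-- Only spiders with a non-zero angle carry variables; Hadamard vertices have degree 2. -/
def Admissible : Vertex 𝒱 → Prop
  | spider _ α U _ => α = 0 → U = ∅
  | hadamard A => A.card = 2

/-- A vertex is unconditional when it carries no variables. -/
def Unconditional : Vertex 𝒱 → Prop
  | spider _ _ U _ => U = ∅
  | hadamard _ => True

/-- Rename the wires. -/
def rename (f : ℕ → ℕ) : Vertex 𝒱 → Vertex 𝒱
  | spider c α U A => spider c α U (A.map f)
  | hadamard A => hadamard (A.map f)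

end Vertex

/-- The data of an open graph with ordered inputs and outputs: the `k`-th entry of `inputs` is the
wire attached to the `k`-th input vertex, and similarly for `outputs`. -/
structure PreDiagram (𝒱 : Type u) where
  inputs : List ℕ
  outputs : List ℕ
  vertices : Multiset (Vertex 𝒱)

/-- All ends of wires, each wire being listed once for each of its ends. -/
def PreDiagram.ends {𝒱 : Type u} (D : PreDiagram 𝒱) : Multiset ℕ :=
  (D.inputs : Multiset ℕ) + (D.outputs : Multiset ℕ) + D.vertices.bind Vertex.legs

/-- A conditional diagram with variables in `𝒱`: every wire that occurs has exactly two ends, and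
every interior vertex is admissible. -/
structure Diagram (𝒱 : Type u) extends PreDiagram 𝒱 where
  two_ends : ∀ w ∈ toPreDiagram.ends, toPreDiagram.ends.count w = 2
  admissible : ∀ x ∈ vertices, x.Admissible

/-- A diagram without conditional vertices. -/
def Diagram.Unconditional {𝒱 : Type u} (D : Diagram 𝒱) : Prop :=
  ∀ x ∈ D.vertices, x.Unconditional

/-! ### Valuations and interpretation -/

/-- The label set `U` is active under the valuation `v`: it is empty (an unconditional vertex), or
`∑ s ∈ U, v s ≠ 0`. -/
def Active {𝒱 : Type u} (v : 𝒱 → Bool) (U : Finset 𝒱) : Prop :=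
  U = ∅ ∨ ∃ s ∈ U, v s = true

open Classical in
/-- The angle which the valuation `v` gives to a vertex labelled by `α, U`. -/
noncomputable def angleAt {𝒱 : Type u} (v : 𝒱 → Bool) (α : Real.Angle) (U : Finset 𝒱) :
    Real.Angle :=
  if Active v U then α else 0

/-- The relabelling of a vertex by a valuation. -/
noncomputable def Vertex.instantiate {𝒱 : Type u} (v : 𝒱 → Bool) : Vertex 𝒱 → Vertex 𝒱
  | spider c α U A => spider c (angleAt v α U) ∅ A
  | hadamard A => hadamard A

/-- The unconditional diagram obtained from a diagram and a valuation. -/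
noncomputable def PreDiagram.instantiate {𝒱 : Type u} (v : 𝒱 → Bool) (D : PreDiagram 𝒱) :
    PreDiagram 𝒱 where
  inputs := D.inputs
  outputs := D.outputs
  vertices := D.vertices.map (Vertex.instantiate v)

/-- The phase factor `e^{iα}`. -/
noncomputable def expI (α : Real.Angle) : ℂ := (α.toCircle : ℂ)

/-- The coefficient `(-1)^b / √2` of `|b⟩` in `|-⟩`. -/
noncomputable def minusCoeff (b : Bool) : ℂ := (if b then -1 else 1) / (Real.sqrt 2 : ℂ)

/-- The tensor entry of an (unconditional) vertex when wire `w` carries the basis state `|b w⟩`.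
A `Z` spider is `|0⋯0⟩⟨0⋯0| + e^{iα} |1⋯1⟩⟨1⋯1|`, an `X` spider is
`|+⋯+⟩⟨+⋯+| + e^{iα} |-⋯-⟩⟨-⋯-|`, and a Hadamard vertex has entries `(-1)^{xy} / √2`. -/
noncomputable def Vertex.entry {𝒱 : Type u} (b : ℕ → Bool) : Vertex 𝒱 → ℂ
  | spider .Z α _ A =>
      (A.map fun w => if b w then (0 : ℂ) else 1).prod
        + expI α * (A.map fun w => if b w then (1 : ℂ) else 0).prod
  | spider .X α _ A =>
      (A.map fun _ => 1 / (Real.sqrt 2 : ℂ)).prod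
        + expI α * (A.map fun w => minusCoeff (b w)).prod
  | hadamard A => (if ∀ w ∈ A, b w = true then -1 else 1) / (Real.sqrt 2 : ℂ)

/-- The matrix entry `⟨y| ⟦D⟧ |x⟩` of the interpretation of an (unconditional) diagram: the
product of the tensor entries of all vertices, summed over all the ways to put a basis state on
each wire which agree with `x` on the inputs and with `y` on the outputs. The finite set `T`
consists of the wires which carry `|1⟩`. -/
noncomputable def PreDiagram.denote {𝒱 : Type u} (D : PreDiagram 𝒱) (x y : List Bool) : ℂ :=
  ∑ T ∈ D.ends.toFinset.powerset,
    if D.inputs.map (fun w => decide (w ∈ T)) = x ∧ D.outputs.map (fun w => decide (w ∈ T)) = y then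
      (D.vertices.map (Vertex.entry fun w => decide (w ∈ T))).prod
    else 0

/-! ### Rewriting -/

/-- Local rewrite rules `L → R`, in which `L` and `R` have the same open wires. Both colourings of
each rule are included, since the colour `c` is arbitrary. Rules hold up to a scalar factor. -/
inductive LocalRule {𝒱 : Type u} : Multiset (Vertex 𝒱) → Multiset (Vertex 𝒱) → Prop
  /-- Two spiders of one colour joined by one or more wires merge, and their angles add up, if this
  is so in every valuation. -/
  | spider (c : Colour) (α β γ : Real.Angle) (U V W : Finset 𝒱) (A B K : Multiset ℕ)
      (hK : K ≠ 0) (h : ∀ v, angleAt v α U + angleAt v β V = angleAt v γ W) :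
      LocalRule {.spider c α U (A + K), .spider c β V (B + K)} {.spider c γ W (A + B)}
  /-- A self-loop can be removed. -/
  | antiLoop (c : Colour) (α : Real.Angle) (U : Finset 𝒱) (a : ℕ) (A : Multiset ℕ) :
      LocalRule {.spider c α U (A + {a, a})} {.spider c α U A}
  /-- The labels of adjacent spiders of one colour can be exchanged. -/
  | commute (c : Colour) (α β : Real.Angle) (U V : Finset 𝒱) (A B K : Multiset ℕ) (hK : K ≠ 0) :
      LocalRule {.spider c α U (A + K), .spider c β V (B + K)}
        {.spider c β V (A + K), .spider c α U (B + K)}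
  /-- A spider copies the unit of the other colour. -/
  | copying (c : Colour) (a : ℕ) (A : Multiset ℕ) :
      LocalRule {.spider c.swap 0 ∅ {a}, .spider c 0 ∅ (A + {a})}
        (A.map fun b => .spider c.swap 0 ∅ {b})
  /-- A (conditional) `π` moves through a spider of the other colour, from the leg `a` to all the
  other legs `p.1` (the wires `p.2` are new), and negates the angle of the spider. -/
  | piCommute (c : Colour) (α β : Real.Angle) (U V W : Finset 𝒱) (a b : ℕ) (P : Multiset (ℕ × ℕ))
      (h : ∀ v, (Active v U → angleAt v β W = -angleAt v α V) ∧
        (¬ Active v U → angleAt v β W = angleAt v α V)) :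
      LocalRule {.spider c.swap (Real.pi : ℝ) U {a, b}, .spider c α V (P.map Prod.fst + {b})}
        (.spider c β W (P.map Prod.snd + {a}) ::ₘ
          P.map fun p => .spider c.swap (Real.pi : ℝ) U {p.1, p.2})
  /-- The bialgebra law, with open wires `x₁ x₂` and `y₁ y₂`. -/
  | bialgebra (c : Colour) (x₁ x₂ y₁ y₂ k₁₁ k₁₂ k₂₁ k₂₂ k : ℕ) :
      LocalRule
        {.spider c 0 ∅ {x₁, k₁₁, k₁₂}, .spider c 0 ∅ {x₂, k₂₁, k₂₂},
          .spider c.swap 0 ∅ {y₁, k₁₁, k₂₁}, .spider c.swap 0 ∅ {y₂, k₁₂, k₂₂}}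
        {.spider c.swap 0 ∅ {x₁, x₂, k}, .spider c 0 ∅ {k, y₁, y₂}}
  /-- Two parallel wires between spiders of different colours can be removed. -/
  | hopf (c : Colour) (α β : Real.Angle) (U V : Finset 𝒱) (a b : ℕ) (A B : Multiset ℕ) :
      LocalRule {.spider c α U (A + {a, b}), .spider c.swap β V (B + {a, b})}
        {.spider c α U A, .spider c.swap β V B}
  /-- A spider with a Hadamard vertex on each leg is the spider of the other colour. -/
  | hCommute (c : Colour) (α : Real.Angle) (U : Finset 𝒱) (P : Multiset (ℕ × ℕ)) :
      LocalRule (.spider c α U (P.map Prod.snd) ::ₘ P.map fun p => .hadamard {p.1, p.2})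
        {.spider c.swap α U (P.map Prod.fst)}
  /-- A closed subdiagram is a scalar, and can be dropped if it is a normalising factor: its value
  is non-zero and has the same modulus in every valuation. -/
  | scalar (K : Diagram 𝒱) (hin : K.inputs = []) (hout : K.outputs = []) (r : ℝ) (hr : 0 < r)
      (h : ∀ v, ‖(K.toPreDiagram.instantiate v).denote [] []‖ = r) :
      LocalRule K.vertices 0

/-- The function which renames the wire `b` to `a`. -/
def joinWire (a b : ℕ) (w : ℕ) : ℕ := if w = b then a else w

/-- Rename the wires of a diagram. -/
def PreDiagram.rename {𝒱 : Type u} (f : ℕ → ℕ) (D : PreDiagram 𝒱) : PreDiagram 𝒱 where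
  inputs := D.inputs.map f
  outputs := D.outputs.map f
  vertices := D.vertices.map (Vertex.rename f)

/-- One rewrite step. Since wires of diagrams have exactly two ends, the internal wires of the two
sides of a rule do not occur in the context. -/
inductive Step {𝒱 : Type u} : PreDiagram 𝒱 → PreDiagram 𝒱 → Prop
  /-- Substitution of the right side of a local rule for the left side. -/
  | replace (ins outs : List ℕ) (L R C : Multiset (Vertex 𝒱)) (h : LocalRule L R) :
      Step ⟨ins, outs, L + C⟩ ⟨ins, outs, R + C⟩
  /-- A spider of degree two and angle zero is replaced with a wire. -/
  | identity (ins outs : List ℕ) (c : Colour) (a b : ℕ) (hab : a ≠ b) (C : Multiset (Vertex 𝒱)) :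
      Step ⟨ins, outs, .spider c 0 ∅ {a, b} ::ₘ C⟩ (PreDiagram.rename (joinWire a b) ⟨ins, outs, C⟩)
  /-- Two consecutive Hadamard vertices are replaced with a wire. -/
  | hCancel (ins outs : List ℕ) (a k b : ℕ) (hab : a ≠ b) (C : Multiset (Vertex 𝒱)) :
      Step ⟨ins, outs, .hadamard {a, k} ::ₘ .hadamard {k, b} ::ₘ C⟩
        (PreDiagram.rename (joinWire a b) ⟨ins, outs, C⟩)
  /-- Diagrams that are isomorphic as labelled graphs are the same. -/
  | iso (D : PreDiagram 𝒱) (f : Equiv.Perm ℕ) : Step D (D.rename f)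

/-- `D` can be rewritten to `D'`: there is a finite sequence of diagrams from `D` to `D'` in which
neighbours differ by a rewrite step, each rule being usable in both directions. -/
def Rewrites {𝒱 : Type u} (D D' : Diagram 𝒱) : Prop :=
  Relation.EqvGen (fun E E' : Diagram 𝒱 => Step E.toPreDiagram E'.toPreDiagram) D D'

/-! ### Patterns of the measurement calculus -/

/-- Commands on qubits in `Q`. The signal that holds the outcome of the measurement of qubit `s` is
also called `s`; a correction is controlled by a signal, or it is unconditional (`none`). -/
inductive Command (Q : Type u)
  | prepare (i : Q)
  | entangle (i j : Q)
  | measure (i : Q) (α : Real.Angle)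
  | correctX (i : Q) (s : Option Q)
  | correctZ (i : Q) (s : Option Q)

namespace Command

variable {Q : Type u}

/-- The command acts on the qubit `q`. -/
def ActsOn : Command Q → Q → Prop
  | prepare i, q => q = i
  | entangle i j, q => q = i ∨ q = j
  | measure i _, q => q = i
  | correctX i _, q => q = i
  | correctZ i _, q => q = i

/-- The command is controlled by the signal `s`. -/
def DependsOn : Command Q → Q → Prop
  | correctX _ t, s => t = some s
  | correctZ _ t, s => t = some s
  | _, _ => False

end Command

/-- A pattern on the qubits `Q`: a sequence of commands, the first one to be executed at the head,
which satisfies the determinacy conditions. -/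
structure Pattern (Q : Type u) where
  commands : List (Command Q)
  entangle_ne : ∀ i j, .entangle i j ∈ commands → i ≠ j
  prepare_first : ∀ pre i post, commands = pre ++ .prepare i :: post → ∀ c ∈ pre, ¬ c.ActsOn i
  measure_last : ∀ pre i α post, commands = pre ++ .measure i α :: post →
    ∀ c ∈ post, ¬ c.ActsOn i
  causal : ∀ pre c post s, commands = pre ++ c :: post → c.DependsOn s →
    ∃ α, .measure s α ∈ pre

namespace Pattern

variable {Q : Type u}

open Classical in
/-- The input qubits are those which are not prepared. -/
noncomputable def inputs [Fintype Q] (P : Pattern Q) : Finset Q :=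
  Finset.univ.filter fun q => .prepare q ∉ P.commands

open Classical in
/-- The output qubits are those which are not measured. -/
noncomputable def outputs [Fintype Q] (P : Pattern Q) : Finset Q :=
  Finset.univ.filter fun q => ∀ α, .measure q α ∉ P.commands

end Pattern

/-! ### Branch maps -/

/-- The value of the control of a correction, when the measurements have the outcomes `v`. -/
def controlValue {Q : Type u} (v : Q → Bool) : Option Q → Bool
  | none => true
  | some s => v s

/-- The action of a command on an unnormalised state, when the measurements have the outcomes `v`
(`false` for `|+_α⟩`, `true` for `|-_α⟩`). The state of a register `A ⊆ Q` is given by its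
amplitudes in the standard basis, as a function of `x : Q → Bool` which depends only on the bits
`x q` with `q ∈ A`. A measurement of qubit `i` in the basis `|±_α⟩` applies `⟨+_α|` or `⟨-_α|` to
that qubit and removes it from the register. -/
noncomputable def Command.run {Q : Type u} [DecidableEq Q] (v : Q → Bool) :
    Command Q → ((Q → Bool) → ℂ) → ((Q → Bool) → ℂ)
  | prepare _, ψ => fun x => ψ x / (Real.sqrt 2 : ℂ)
  | entangle i j, ψ => fun x => if x i && x j then -ψ x else ψ x
  | measure i α, ψ => fun x =>
      (ψ (Function.update x i false) + (if v i then -1 else 1) * expI (-α) *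
        ψ (Function.update x i true)) / (Real.sqrt 2 : ℂ)
  | correctX i s, ψ => fun x =>
      if controlValue v s then ψ (Function.update x i (!x i)) else ψ x
  | correctZ i s, ψ => fun x => if controlValue v s && x i then -ψ x else ψ x

namespace Pattern

variable {Q : Type u}

open Classical in
/-- The basis state `|a⟩` of the input register. -/
noncomputable def inputState [Fintype Q] (P : Pattern Q) (a : P.inputs → Bool) : (Q → Bool) → ℂ :=
  fun x => if ∀ q : P.inputs, x q = a q then 1 else 0

open Classical in
/-- The branch map of the pattern for the outcomes `v` of the measurements (values of `v` at qubits
that are not measured play no role), as a matrix from the input register to the output register. -/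
noncomputable def branchMap [Fintype Q] (P : Pattern Q) (v : Q → Bool) :
    Matrix (P.outputs → Bool) (P.inputs → Bool) ℂ :=
  Matrix.of fun y a =>
    (P.commands.foldl (fun ψ c => c.run v ψ) (P.inputState a))
      (fun q => if h : q ∈ P.outputs then y ⟨q, h⟩ else false)

/-- All branch maps coincide, as operations on quantum states, that is up to a global phase. -/
def StronglyDeterministic [Fintype Q] (P : Pattern Q) : Prop :=
  ∀ v w : Q → Bool, ∃ z : ℂ, ‖z‖ = 1 ∧ P.branchMap v = z • P.branchMap w

end Pattern

/-! ### The diagram of a pattern -/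

/-- A partial translation: the vertices so far, the wire at which each qubit of the current register
ends, and the first unused wire. -/
structure Partial (Q : Type u) where
  vertices : Multiset (Vertex Q)
  wire : Q → ℕ
  next : ℕ

/-- The label set of a correction. -/
def controlLabel {Q : Type u} : Option Q → Finset Q
  | none => ∅
  | some s => {s}

/-- Append the subdiagram of a command. -/
noncomputable def Partial.append {Q : Type u} [DecidableEq Q] (t : Partial Q) :
    Command Q → Partial Q
  | .prepare i =>
      { vertices := .spider .Z 0 ∅ {t.next} ::ₘ t.vertices
        wire := Function.update t.wire i t.next
        next := t.next + 1 }
  | .entangle i j =>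
      { vertices := .spider .Z 0 ∅ {t.wire i, t.next, t.next + 2} ::ₘ
          .spider .Z 0 ∅ {t.wire j, t.next + 1, t.next + 3} ::ₘ
          .hadamard {t.next + 2, t.next + 3} ::ₘ t.vertices
        wire := Function.update (Function.update t.wire i t.next) j (t.next + 1)
        next := t.next + 4 }
  | .measure i α =>
      { vertices := .spider .Z (Real.pi : ℝ) {i} {t.wire i, t.next} ::ₘ
          .spider .Z (-α) ∅ {t.next} ::ₘ t.vertices
        wire := t.wire
        next := t.next + 1 }
  | .correctX i s =>
      { vertices := .spider .X (Real.pi : ℝ) (controlLabel s) {t.wire i, t.next} ::ₘ t.vertices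
        wire := Function.update t.wire i t.next
        next := t.next + 1 }
  | .correctZ i s =>
      { vertices := .spider .Z (Real.pi : ℝ) (controlLabel s) {t.wire i, t.next} ::ₘ t.vertices
        wire := Function.update t.wire i t.next
        next := t.next + 1 }

namespace Pattern

variable {Q : Type u} [Fintype Q] [LinearOrder Q]

/-- The translation starts with one bare wire for each input qubit, in the order of `Q`. -/
noncomputable def initialPartial (P : Pattern Q) : Partial Q where
  vertices := 0
  wire := fun q => (P.inputs.sort (· ≤ ·)).idxOf q
  next := P.inputs.card

/-- The translation of the whole command sequence. -/
noncomputable def finalPartial (P : Pattern Q) : Partial Q :=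
  P.commands.foldl Partial.append P.initialPartial

/-- The data of the diagram of a pattern. -/
noncomputable def preDiagram (P : Pattern Q) : PreDiagram Q where
  inputs := (P.inputs.sort (· ≤ ·)).map P.initialPartial.wire
  outputs := (P.outputs.sort (· ≤ ·)).map P.finalPartial.wire
  vertices := P.finalPartial.vertices

/-! The diagram of a pattern is a diagram: every wire has two ends. -/

/-- Every wire in `E` occurs twice, and its number is below `n`. -/
def Paired (E : Multiset ℕ) (n : ℕ) : Prop :=
  (∀ w ∈ E, E.count w = 2) ∧ ∀ w ∈ E, w < n

set_option linter.unusedSectionVars false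

theorem Paired.extend {E S : Multiset ℕ} {n m : ℕ} (h : Paired E n) (hS : S.Nodup)
    (hSn : ∀ w ∈ S, n ≤ w ∧ w < m) (hnm : n ≤ m) : Paired (E + (S + S)) m := by
  refine ⟨fun w hw => ?_, fun w hw => ?_⟩
  · by_cases hE : w ∈ E
    · have hwS : w ∉ S := fun h' => absurd (h.2 w hE) (by have := (hSn w h').1; omega)
      simp [Multiset.count_eq_zero_of_notMem hwS, h.1 w hE]
    · have hwS : w ∈ S := by simpa [hE] using hw
      simp [Multiset.count_eq_zero_of_notMem hE, Multiset.count_eq_one_of_mem hS hwS]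
  · rcases Multiset.mem_add.1 hw with hw | hw
    · exact lt_of_lt_of_le (h.2 w hw) hnm
    · rcases Multiset.mem_add.1 hw with hw | hw <;> exact (hSn w hw).2

/-- The ends of wires in a partial translation with current register `A`. -/
def _root_.MBQC.Partial.ends (t : Partial Q) (ins : List ℕ) (A : Multiset Q) : Multiset ℕ :=
  (ins : Multiset ℕ) + A.map t.wire + t.vertices.bind Vertex.legs

theorem map_update_of_notMem (f : Q → ℕ) (i : Q) (n : ℕ) {B : Multiset Q} (h : i ∉ B) :
    B.map (Function.update f i n) = B.map f :=
  Multiset.map_congr rfl fun q hq => Function.update_of_ne (fun e : q = i => h (e ▸ hq)) _ _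

theorem ends_prepare (t : Partial Q) (ins : List ℕ) (B : Multiset Q) (i : Q) (h : i ∉ B) :
    (t.append (.prepare i)).ends ins (i ::ₘ B) = t.ends ins B + ({t.next} + {t.next}) := by
  simp only [Partial.ends, Partial.append, Multiset.map_cons, Function.update_self,
    map_update_of_notMem _ _ _ h, Multiset.cons_bind, Vertex.legs]
  simp only [← Multiset.singleton_add]
  abel

theorem ends_measure (t : Partial Q) (ins : List ℕ) (B : Multiset Q) (i : Q) (α : Real.Angle) :
    (t.append (.measure i α)).ends ins B = t.ends ins (i ::ₘ B) + ({t.next} + {t.next}) := by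
  simp only [Partial.ends, Partial.append, Multiset.map_cons, Multiset.cons_bind, Vertex.legs, Multiset.insert_eq_cons]
  simp only [← Multiset.singleton_add]
  abel

theorem ends_correctX (t : Partial Q) (ins : List ℕ) (B : Multiset Q) (i : Q) (s : Option Q)
    (h : i ∉ B) :
    (t.append (.correctX i s)).ends ins (i ::ₘ B) =
      t.ends ins (i ::ₘ B) + ({t.next} + {t.next}) := by
  simp only [Partial.ends, Partial.append, Multiset.map_cons, Function.update_self,
    map_update_of_notMem _ _ _ h, Multiset.cons_bind, Vertex.legs, Multiset.insert_eq_cons]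
  simp only [← Multiset.singleton_add]
  abel

theorem ends_correctZ (t : Partial Q) (ins : List ℕ) (B : Multiset Q) (i : Q) (s : Option Q)
    (h : i ∉ B) :
    (t.append (.correctZ i s)).ends ins (i ::ₘ B) =
      t.ends ins (i ::ₘ B) + ({t.next} + {t.next}) := by
  simp only [Partial.ends, Partial.append, Multiset.map_cons, Function.update_self,
    map_update_of_notMem _ _ _ h, Multiset.cons_bind, Vertex.legs, Multiset.insert_eq_cons]
  simp only [← Multiset.singleton_add]
  abel

theorem ends_entangle (t : Partial Q) (ins : List ℕ) (B : Multiset Q) (i j : Q) (hij : i ≠ j)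
    (hi : i ∉ B) (hj : j ∉ B) :
    (t.append (.entangle i j)).ends ins (i ::ₘ j ::ₘ B) = t.ends ins (i ::ₘ j ::ₘ B) +
      (({t.next, t.next + 1, t.next + 2, t.next + 3} : Multiset ℕ) +
        {t.next, t.next + 1, t.next + 2, t.next + 3}) := by
  simp only [Partial.ends, Partial.append, Multiset.map_cons, Function.update_self,
    Function.update_of_ne hij, map_update_of_notMem _ _ _ hi, map_update_of_notMem _ _ _ hj,
    Multiset.cons_bind, Vertex.legs, Multiset.insert_eq_cons]
  simp only [← Multiset.singleton_add]
  abel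

open Classical in
/-- The register after a part of the commands. -/
noncomputable def live (P : Pattern Q) (pre : List (Command Q)) : Finset Q :=
  Finset.univ.filter fun q =>
    (.prepare q ∈ P.commands → .prepare q ∈ pre) ∧ ∀ α, .measure q α ∉ pre

theorem mem_live_of_actsOn (P : Pattern Q) {pre post : List (Command Q)} {c : Command Q} {q : Q}
    (h : P.commands = pre ++ c :: post) (hc : c.ActsOn q) (hn : c ≠ .prepare q) :
    q ∈ P.live pre := by
  simp only [live, Finset.mem_filter, Finset.mem_univ, true_and]
  constructor
  · intro hq
    rw [h] at hq
    rcases List.mem_append.1 hq with hq | hq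
    · exact hq
    · rcases List.mem_cons.1 hq with hq | hq
      · exact absurd hq.symm hn
      · obtain ⟨s, u, rfl⟩ := List.append_of_mem hq
        exact absurd hc (P.prepare_first (pre ++ c :: s) q u (by simp [h]) c (by simp))
  · intro α hα
    obtain ⟨s, u, rfl⟩ := List.append_of_mem hα
    exact P.measure_last s q α (u ++ c :: post) (by simp [h]) c (by simp) hc

theorem live_append_prepare (P : Pattern Q) {pre post : List (Command Q)} {i : Q}
    (h : P.commands = pre ++ .prepare i :: post) :
    i ∉ P.live pre ∧ P.live (pre ++ [.prepare i]) = insert i (P.live pre) := by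
  have h1 := P.prepare_first pre i post h
  have h2 : ∀ α, .measure i α ∉ pre := fun α hα => h1 _ hα rfl
  have h3 : .prepare i ∉ pre := fun hα => h1 _ hα rfl
  have h4 : .prepare i ∈ P.commands := by simp [h]
  constructor
  · simp [live, h3, h4]
  · ext q
    by_cases hq : q = i
    · subst hq
      simp [live, h2]
    · simp [live, hq]

theorem live_append_measure (P : Pattern Q) (pre : List (Command Q)) (i : Q) (α : Real.Angle) :
    P.live (pre ++ [.measure i α]) = (P.live pre).erase i := by
  ext q
  by_cases hq : q = i
  · subst hq
    simp only [live, Finset.mem_filter, Finset.mem_univ, true_and, Finset.mem_erase]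
    constructor
    · intro h
      exact absurd (by simp) (h.2 α)
    · intro h
      exact absurd rfl h.1
  · simp [live, hq]

theorem live_append_other (P : Pattern Q) (pre : List (Command Q)) (c : Command Q)
    (h1 : ∀ q, c ≠ .prepare q) (h2 : ∀ q α, c ≠ .measure q α) :
    P.live (pre ++ [c]) = P.live pre := by
  ext q
  simp [live, (h1 q).symm, (h2 q _).symm]

theorem val_eq_cons {A : Finset Q} {i : Q} (h : i ∈ A) : A.val = i ::ₘ (A.erase i).val := by
  rw [Finset.erase_val, Multiset.cons_erase h]

theorem paired_append (P : Pattern Q) (ins : List ℕ) (t : Partial Q)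
    {pre post : List (Command Q)} (c : Command Q) (h : P.commands = pre ++ c :: post)
    (ht : Paired (t.ends ins (P.live pre).val) t.next)
    (hv : ∀ x ∈ t.vertices, x.Admissible) :
    Paired ((t.append c).ends ins (P.live (pre ++ [c])).val) (t.append c).next ∧
      ∀ x ∈ (t.append c).vertices, x.Admissible := by
  have hpi : ((Real.pi : ℝ) : Real.Angle) ≠ 0 := Real.Angle.pi_ne_zero
  have hone : Paired (t.ends ins (P.live pre).val + ({t.next} + {t.next})) (t.next + 1) :=
    ht.extend (Multiset.nodup_singleton _) (by simp) (by omega)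
  cases c with
  | prepare i =>
    obtain ⟨h1, h2⟩ := P.live_append_prepare h
    refine ⟨?_, by simpa [Partial.append, Vertex.Admissible] using hv⟩
    rw [h2, Finset.insert_val_of_notMem h1, ends_prepare _ _ _ _ h1]
    exact hone
  | measure i α =>
    have hi : i ∈ P.live pre := P.mem_live_of_actsOn h rfl (by simp)
    refine ⟨?_, by simpa [Partial.append, Vertex.Admissible, hpi] using hv⟩
    rw [live_append_measure, ends_measure, ← val_eq_cons hi]
    exact hone
  | correctX i s =>
    have hi : i ∈ P.live pre := P.mem_live_of_actsOn h rfl (by simp)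
    refine ⟨?_, by simpa [Partial.append, Vertex.Admissible, hpi] using hv⟩
    rw [live_append_other _ _ _ (by simp) (by simp), val_eq_cons hi,
      ends_correctX _ _ _ _ _ (Finset.notMem_erase i _), ← val_eq_cons hi]
    exact hone
  | correctZ i s =>
    have hi : i ∈ P.live pre := P.mem_live_of_actsOn h rfl (by simp)
    refine ⟨?_, by simpa [Partial.append, Vertex.Admissible, hpi] using hv⟩
    rw [live_append_other _ _ _ (by simp) (by simp), val_eq_cons hi,
      ends_correctZ _ _ _ _ _ (Finset.notMem_erase i _), ← val_eq_cons hi]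
    exact hone
  | entangle i j =>
    have hij : i ≠ j := P.entangle_ne i j (by simp [h])
    have hi : i ∈ P.live pre := P.mem_live_of_actsOn h (Or.inl rfl) (by simp)
    have hj : j ∈ P.live pre := P.mem_live_of_actsOn h (Or.inr rfl) (by simp)
    have hj' : j ∈ (P.live pre).erase i := Finset.mem_erase.2 ⟨hij.symm, hj⟩
    refine ⟨?_, by simpa [Partial.append, Vertex.Admissible] using hv⟩
    rw [live_append_other _ _ _ (by simp) (by simp), val_eq_cons hi, val_eq_cons hj',
      ends_entangle _ _ _ _ _ hij (fun e => Finset.notMem_erase i _ (Finset.mem_of_mem_erase e))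
        (Finset.notMem_erase j _), ← val_eq_cons hj', ← val_eq_cons hi]
    exact ht.extend (by simp) (by simp [Partial.append]) (by simp [Partial.append])

theorem paired_foldl (P : Pattern Q) (ins : List ℕ) (post pre : List (Command Q)) (t : Partial Q)
    (h : P.commands = pre ++ post) (ht : Paired (t.ends ins (P.live pre).val) t.next)
    (hv : ∀ x ∈ t.vertices, x.Admissible) :
    (∃ n, Paired ((post.foldl Partial.append t).ends ins (P.live P.commands).val) n) ∧
      ∀ x ∈ (post.foldl Partial.append t).vertices, x.Admissible := by
  induction post generalizing pre t with
  | nil => exact ⟨⟨_, by simpa [h] using ht⟩, hv⟩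
  | cons c post ih =>
    obtain ⟨h1, h2⟩ := P.paired_append ins t c h ht hv
    exact ih (pre ++ [c]) (t.append c) (by simp [h]) h1 h2

theorem live_nil (P : Pattern Q) : P.live [] = P.inputs := by
  ext q
  simp [live, inputs]

theorem live_commands (P : Pattern Q) : P.live P.commands = P.outputs := by
  ext q
  simp [live, outputs]

theorem paired_initial (P : Pattern Q) :
    Paired (P.initialPartial.ends P.preDiagram.inputs (P.live []).val) P.initialPartial.next := by
  have hperm : ((P.inputs.sort (· ≤ ·) : List Q) : Multiset Q) = P.inputs.val := by simp
  set S : Multiset ℕ := P.inputs.val.map P.initialPartial.wire with hS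
  have hE : P.initialPartial.ends P.preDiagram.inputs (P.live []).val = 0 + (S + S) := by
    rw [live_nil, Partial.ends, preDiagram, ← Multiset.map_coe, hperm]
    simp [initialPartial, hS]
  have h0 : Paired 0 0 := ⟨by simp, by simp⟩
  rw [hE]
  refine h0.extend ?_ ?_ (Nat.zero_le _)
  · refine Multiset.Nodup.map_on ?_ P.inputs.nodup
    intro q hq q' _ e
    exact (List.idxOf_inj ((Finset.mem_sort (· ≤ ·)).2 hq)).1 e
  · intro w hw
    obtain ⟨q, hq, rfl⟩ := Multiset.mem_map.1 hw
    refine ⟨Nat.zero_le _, ?_⟩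
    have := List.idxOf_lt_length_of_mem ((Finset.mem_sort (· ≤ ·)).2 hq)
    simpa [initialPartial] using this

theorem paired_final (P : Pattern Q) :
    (∃ n, Paired P.preDiagram.ends n) ∧ ∀ x ∈ P.preDiagram.vertices, x.Admissible := by
  obtain ⟨⟨n, h1⟩, h2⟩ := P.paired_foldl P.preDiagram.inputs P.commands [] P.initialPartial rfl
    P.paired_initial (by simp [initialPartial])
  have hperm : ((P.outputs.sort (· ≤ ·) : List Q) : Multiset Q) = P.outputs.val := by simp
  refine ⟨⟨n, ?_⟩, h2⟩
  rw [live_commands] at h1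
  have : P.preDiagram.ends =
      P.finalPartial.ends P.preDiagram.inputs P.outputs.val := by
    rw [Partial.ends, ← hperm, Multiset.map_coe]
    rfl
  rw [this]
  exact h1

/-- The conditional diagram `D(P)` of a pattern. Its variables are the signals. -/
noncomputable def diagram (P : Pattern Q) : Diagram Q where
  toPreDiagram := P.preDiagram
  two_ends := P.paired_final.1.choose_spec.1
  admissible := P.paired_final.2

end Pattern

end MBQC

namespace MBQC

universe u

/-! ### Sums over the basis states on wires -/

/-! Fix a valuation `v` of the signals. A diagram then denotes a tensor contraction: a sum, over all
bits on the wires, of a product of factors each of which sees only the legs of one vertex. The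
theorem combines two facts about this sum.

First, rewriting multiplies the interpretation by a scalar `k v` whose modulus is positive and the
same for all `v` (`Rewrites.proportional`). The scalar itself may vary: π-commute contributes
`e^{iα}` exactly where the π is active, and a dropped closed subdiagram contributes its value. A
local rule is checked in isolation, by summing over its internal wires only (`LocalRule.soundRule`);
these can be summed first in any context (`denote_add`), because a wire with both ends inside the
subdiagram has no end elsewhere. Most rules come down to facts about the two bases attached to the
colours: each is orthonormal, they are mutually unbiased, the Hadamard matrix exchanges them, and
the π of one colour swaps the two vectors of the other. The bialgebra law is a parity computation.

Second, the diagram of a pattern under `v` denotes the branch map of `v` times a positive constant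
independent of `v` (`Pattern.exists_denote_diagram`). This is an induction along the commands, in
which `Partial.registerSum` is compared with the state that has been computed so far.

An unconditional diagram has one interpretation for all valuations. Hence all branch maps are
multiples of a single matrix, by scalars of equal modulus, and the quotient of two such scalars is a
phase. -/

/-- Sum a function over the two basis states on the wire `w`. -/
noncomputable def sumWire (w : ℕ) (F : (ℕ → Bool) → ℂ) (b : ℕ → Bool) : ℂ :=
  F (Function.update b w false) + F (Function.update b w true)

/-- Sums over different wires commute, which makes the fold over a multiset of wires well defined.
-/
instance : LeftCommutative sumWire where
  left_comm w w' F := by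
    rcases eq_or_ne w w' with rfl | h
    · rfl
    · funext b
      simp only [sumWire, Function.update_comm h]
      ring

/-- Sum a function over the basis states on several wires. -/
noncomputable def sumWires (I : Multiset ℕ) (F : (ℕ → Bool) → ℂ) : (ℕ → Bool) → ℂ :=
  I.foldr sumWire F

@[simp]
theorem sumWires_zero (F : (ℕ → Bool) → ℂ) : sumWires 0 F = F := rfl

theorem sumWires_cons (w : ℕ) (I : Multiset ℕ) (F : (ℕ → Bool) → ℂ) :
    sumWires (w ::ₘ I) F = sumWire w (sumWires I F) :=
  Multiset.foldr_cons _ _ _ _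

@[simp]
theorem sumWires_singleton (w : ℕ) (F : (ℕ → Bool) → ℂ) : sumWires {w} F = sumWire w F :=
  sumWires_cons w 0 F

theorem sumWires_add (I J : Multiset ℕ) (F : (ℕ → Bool) → ℂ) :
    sumWires (I + J) F = sumWires I (sumWires J F) :=
  Multiset.foldr_add _ _ _ _

theorem sumWires_fun_add (I : Multiset ℕ) (F G : (ℕ → Bool) → ℂ) (b : ℕ → Bool) :
    sumWires I (fun b => F b + G b) b = sumWires I F b + sumWires I G b := by
  induction I using Multiset.induction_on generalizing b with
  | empty => rfl
  | cons w I ih =>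
    simp only [sumWires_cons, sumWire, ih]
    ring

/-- The distributive law behind every locality argument: a factor that does not see the summed wires
leaves the sum. `DependsOn` expresses which wires a factor sees. -/
theorem sumWires_mul_left {I : Multiset ℕ} {G : (ℕ → Bool) → ℂ} (hG : DependsOn G {w | w ∉ I})
    (F : (ℕ → Bool) → ℂ) (b : ℕ → Bool) :
    sumWires I (fun b => G b * F b) b = G b * sumWires I F b := by
  induction I using Multiset.induction_on generalizing b with
  | empty => rfl
  | cons w I ih =>
    have hI : DependsOn G {w | w ∉ I} := fun _ _ h =>
      hG fun i hi => h i fun h' => hi (Multiset.mem_cons_of_mem h')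
    have hw : ∀ x, G (Function.update b w x) = G b := fun x => hG fun i hi =>
      Function.update_of_ne (fun e => hi (by simp [e])) _ _
    simp only [sumWires_cons, sumWire, ih hI, hw]
    ring

theorem sumWires_const_mul (I : Multiset ℕ) (c : ℂ) (F : (ℕ → Bool) → ℂ) (b : ℕ → Bool) :
    sumWires I (fun b => c * F b) b = c * sumWires I F b :=
  sumWires_mul_left (G := fun _ => c) (fun _ _ _ => rfl) F b

/-- Summed wires are bound variables. With `s = ∅` this says that a sum over all wires in sight is a
constant, so that the assignment at which it is evaluated is immaterial. -/
theorem dependsOn_sumWires {I : Multiset ℕ} {F : (ℕ → Bool) → ℂ} {s : Set ℕ}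
    (hF : DependsOn F {w | w ∈ s ∨ w ∈ I}) : DependsOn (sumWires I F) s := by
  induction I using Multiset.induction_on generalizing s with
  | empty => simpa using hF
  | cons w I ih =>
    have h : DependsOn (sumWires I F) {i | i ∈ s ∨ i = w} := ih (hF.mono fun i hi => by
      rcases hi with hi | hi
      · exact Or.inl (Or.inl hi)
      · rcases Multiset.mem_cons.1 hi with hi | hi
        · exact Or.inl (Or.inr hi)
        · exact Or.inr hi)
    rw [sumWires_cons]
    intro b b' hb
    have hu : ∀ x, sumWires I F (Function.update b w x) = sumWires I F (Function.update b' w x) :=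
      fun x => h fun i hi => by
        by_cases hw : i = w
        · simp [hw]
        · simpa [hw] using hb i (hi.resolve_right hw)
    simp only [sumWire, hu]

theorem dependsOn_multiset_prod {ι : Type*} {P : Multiset ι} {g : ι → (ℕ → Bool) → ℂ}
    {s : Set ℕ} (h : ∀ p ∈ P, DependsOn (g p) s) :
    DependsOn (fun b => (P.map fun p => g p b).prod) s := fun x y hxy => by
  dsimp only
  rw [Multiset.map_congr rfl fun p hp => h p hp hxy]

theorem dependsOn_legs {A I : Multiset ℕ} (h : ∀ w ∈ I, w ∉ A) (f : Bool → ℂ) :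
    DependsOn (fun b : ℕ → Bool => (A.map fun w => f (b w)).prod) {w | w ∉ I} :=
  dependsOn_multiset_prod (g := fun w b => f (b w)) fun w hw _ _ hxy =>
    congrArg f (hxy w fun h' => h w h' hw)

/-- The sum over distinct wires `s p` of a product with one factor for each of these wires. -/
theorem sumWires_prod {ι : Type*} (P : Multiset ι) (s : ι → ℕ) (g : ι → Bool → (ℕ → Bool) → ℂ)
    (hs : (P.map s).Nodup) (hg : ∀ p ∈ P, ∀ x, DependsOn (g p x) {w | w ∉ P.map s})
    (b : ℕ → Bool) :
    sumWires (P.map s) (fun b => (P.map fun p => g p (b (s p)) b).prod) b =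
      (P.map fun p => g p false b + g p true b).prod := by
  induction P using Multiset.induction_on generalizing b with
  | empty => rfl
  | cons p P ih =>
    rw [Multiset.map_cons] at hs
    obtain ⟨hp, hP⟩ := Multiset.nodup_cons.1 hs
    have hsub : {w | w ∉ (p ::ₘ P).map s} ⊆ {w | w ∉ P.map s} := fun w hw h' =>
      hw (by rw [Multiset.map_cons]; exact Multiset.mem_cons_of_mem h')
    have hsub' : ∀ w ∈ {w | w ∉ (p ::ₘ P).map s}, w ≠ s p := fun w hw e =>
      hw (by simp [e])
    have h1 : DependsOn (fun b => g p (b (s p)) b) {w | w ∉ P.map s} := fun x y hxy => by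
      dsimp only
      rw [hxy (s p) hp]
      exact hg p (Multiset.mem_cons_self _ _) _ fun i hi => hxy i (hsub hi)
    have h2 : ∀ q ∈ p ::ₘ P, ∀ x z, g q x (Function.update b (s p) z) = g q x b :=
      fun q hq x z => hg q hq x fun i hi => Function.update_of_ne (hsub' i hi) _ _
    simp only [Multiset.map_cons, Multiset.prod_cons, sumWires_cons]
    -- The factor of `p` does not see the wires of the other indices, so it comes out of the inner
    -- sum, and the induction hypothesis evaluates what is left.
    have h3 : sumWires (P.map s) (fun b => g p (b (s p)) b *
        (P.map fun q => g q (b (s q)) b).prod) =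
        fun b => g p (b (s p)) b * (P.map fun q => g q false b + g q true b).prod := by
      funext b
      rw [sumWires_mul_left h1, ih hP fun q hq x _ _ h =>
        hg q (Multiset.mem_cons_of_mem hq) x fun i hi => h i (hsub hi)]
    have h4 : ∀ z, (P.map fun q => g q false (Function.update b (s p) z) +
        g q true (Function.update b (s p) z)) = P.map fun q => g q false b + g q true b :=
      fun z => Multiset.map_congr rfl fun q hq => by
        rw [h2 q (Multiset.mem_cons_of_mem hq), h2 q (Multiset.mem_cons_of_mem hq)]
    rw [h3]
    simp only [sumWire, h4, Function.update_self, h2 p (Multiset.mem_cons_self _ _)]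
    ring

/-- The sum over the wires of a set, expressed by the wires which carry `|1⟩`. -/
theorem sum_powerset_eq_sumWires (S : Finset ℕ) (F : (ℕ → Bool) → ℂ) :
    ∑ T ∈ S.powerset, F (fun w => decide (w ∈ T)) = sumWires S.val F fun _ => false := by
  induction S using Finset.induction_on generalizing F with
  | empty => simp
  | insert a S ha ih =>
    have h : ∀ T ∈ S.powerset, F (fun w => decide (w ∈ T)) + F (fun w => decide (w ∈ insert a T)) =
        sumWire a F fun w => decide (w ∈ T) := fun T hT => by
      have haT : a ∉ T := fun h => ha (Finset.mem_powerset.1 hT h)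
      rw [sumWire]
      congr 2 <;> funext w <;> by_cases hw : w = a <;> simp [hw, haT]
    -- The new wire `a` is made the innermost sum, so that the induction hypothesis applies to
    -- `sumWire a F` in place of `F`.
    rw [Finset.sum_powerset_insert ha, ← Finset.sum_add_distrib, Finset.sum_congr rfl h, ih,
      Finset.insert_val_of_notMem ha, ← Multiset.singleton_add, add_comm, sumWires_add,
      sumWires_singleton]

/-- The sum over renamed wires. -/
theorem sumWires_map_perm (f : Equiv.Perm ℕ) (I : Multiset ℕ) (F : (ℕ → Bool) → ℂ)
    (b : ℕ → Bool) :
    sumWires (I.map f) F b = sumWires I (fun b' => F (b' ∘ f.symm)) (b ∘ f) := by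
  induction I using Multiset.induction_on generalizing b with
  | empty => simp [Function.comp_assoc]
  | cons w I ih =>
    have h : ∀ x, Function.update b (f w) x ∘ f = Function.update (b ∘ f) w x := fun x =>
      Function.update_comp_eq_of_injective _ f.injective _ _
    simp only [Multiset.map_cons, sumWires_cons, sumWire, ih, h]

/-- A sum of two products over common wires, expanded. -/
theorem sumWires_mul_expand {I : Multiset ℕ} {p₀ p₁ q₀ q₁ : (ℕ → Bool) → ℂ}
    (hp₀ : DependsOn p₀ {w | w ∉ I}) (hp₁ : DependsOn p₁ {w | w ∉ I})
    (hq₀ : DependsOn q₀ {w | w ∉ I}) (hq₁ : DependsOn q₁ {w | w ∉ I})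
    (κ₀ κ₁ μ₀ μ₁ : (ℕ → Bool) → ℂ) (e f : ℂ) (b : ℕ → Bool) :
    sumWires I (fun b => (p₀ b * κ₀ b + e * (p₁ b * κ₁ b)) * (q₀ b * μ₀ b + f * (q₁ b * μ₁ b))) b =
      p₀ b * q₀ b * sumWires I (fun b => κ₀ b * μ₀ b) b +
      f * (p₀ b * q₁ b * sumWires I (fun b => κ₀ b * μ₁ b) b) +
      e * (p₁ b * q₀ b * sumWires I (fun b => κ₁ b * μ₀ b) b) +
      e * f * (p₁ b * q₁ b * sumWires I (fun b => κ₁ b * μ₁ b) b) := by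
  simp only [mul_assoc]
  simp only [← sumWires_mul_left hp₀, ← sumWires_mul_left hp₁, ← sumWires_mul_left hq₀,
    ← sumWires_mul_left hq₁, ← sumWires_const_mul, ← sumWires_fun_add]
  congr 1
  funext b
  ring

/-! ### Amplitudes of vertices -/

theorem expI_zero : expI 0 = 1 := by simp [expI]

theorem expI_pi : expI (Real.pi : ℝ) = -1 := by
  simp [expI]

theorem expI_add (α β : Real.Angle) : expI (α + β) = expI α * expI β := by
  simp [expI, Real.Angle.toCircle_add]

theorem expI_mul_expI_neg (α : Real.Angle) : expI α * expI (-α) = 1 := by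
  rw [← expI_add, add_neg_cancel, expI_zero]

theorem norm_expI (α : Real.Angle) : ‖expI α‖ = 1 := Circle.norm_coe _

theorem sqrt_two_ne_zero : (Real.sqrt 2 : ℂ) ≠ 0 := by simp

theorem sqrt_two_sq : (Real.sqrt 2 : ℂ) ^ 2 = 2 := by
  rw [← Complex.ofReal_pow, Real.sq_sqrt (by norm_num)]
  norm_num

theorem inv_sqrt_two_sq : ((Real.sqrt 2 : ℂ)⁻¹) ^ 2 = 1 / 2 := by
  rw [inv_pow, sqrt_two_sq]
  norm_num

/-! ### The two bases and their contractions -/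

/-- The coefficient of `|x⟩` in the `j`-th vector of the basis of a colour. -/
noncomputable def basisVec : Colour → Bool → Bool → ℂ
  | .Z, j, x => if x = j then 1 else 0
  | .X, j, x => if j then minusCoeff x else 1 / (Real.sqrt 2 : ℂ)

/-- The entry `(-1)^{ij} / √2` of the Hadamard matrix. -/
noncomputable def hadamardEntry (i j : Bool) : ℂ :=
  (if i && j then -1 else 1) / (Real.sqrt 2 : ℂ)

/-- The coefficients are real, so contracting a wire without conjugation is the inner product.
Spider fusion, label exchange and loop removal rest on this. -/
theorem basisVec_orthonormal (c : Colour) (i j : Bool) :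
    basisVec c i false * basisVec c j false + basisVec c i true * basisVec c j true =
      if i = j then 1 else 0 := by
  have := inv_sqrt_two_sq
  cases c <;> cases i <;> cases j <;> simp [basisVec, minusCoeff] <;> grind

/-- The bases are mutually unbiased: all overlaps have modulus `1/√2`, and their squares are the
constant that the Hopf rule needs. -/
theorem basisVec_overlap (c : Colour) (i j : Bool) :
    basisVec c i false * basisVec c.swap j false + basisVec c i true * basisVec c.swap j true =
      hadamardEntry i j := by
  cases c <;> cases i <;> cases j <;>
    simp [basisVec, minusCoeff, Colour.swap, hadamardEntry]

theorem basisVec_mul_hadamardEntry (c : Colour) (j y : Bool) :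
    basisVec c j false * hadamardEntry y false + basisVec c j true * hadamardEntry y true =
      basisVec c.swap j y := by
  have := inv_sqrt_two_sq
  cases c <;> cases y <;> cases j <;>
    simp [basisVec, minusCoeff, Colour.swap, hadamardEntry] <;> grind

/-- The entry of a spider of degree two of the other colour, with phase factor `e`. -/
noncomputable def twoLegs (c : Colour) (e : ℂ) (y x : Bool) : ℂ :=
  basisVec c false y * basisVec c false x + e * (basisVec c true y * basisVec c true x)

theorem twoLegs_one (c : Colour) (y x : Bool) : twoLegs c 1 y x = if y = x then 1 else 0 := by
  have := inv_sqrt_two_sq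
  cases c <;> cases y <;> cases x <;> simp [twoLegs, basisVec, minusCoeff] <;> grind

theorem twoLegs_neg_one (c : Colour) (y x : Bool) :
    twoLegs c (-1) y x = if c matches .Z then (if y = x then (if x then -1 else 1) else 0)
      else if y = x then 0 else 1 := by
  have := inv_sqrt_two_sq
  cases c <;> cases y <;> cases x <;> simp [twoLegs, basisVec, minusCoeff] <;> grind

theorem basisVec_mul_twoLegs_one (c c' : Colour) (j y : Bool) :
    basisVec c j false * twoLegs c' 1 y false + basisVec c j true * twoLegs c' 1 y true =
      basisVec c j y := by
  cases y <;> simp [twoLegs_one]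

/-- The π spider of the other colour is a Pauli matrix that swaps the two vectors of this basis,
without a sign in either colour. -/
theorem basisVec_mul_twoLegs_neg_one (c : Colour) (j y : Bool) :
    basisVec c j false * twoLegs c.swap (-1) y false +
        basisVec c j true * twoLegs c.swap (-1) y true = basisVec c (!j) y := by
  cases c <;> cases y <;> cases j <;>
    simp [twoLegs_neg_one, basisVec, minusCoeff, Colour.swap, neg_div]

/-- An unlabelled leaf of one colour is `√2` times vector number `0` of the other basis; this is why
such a leaf is copied. -/
theorem basisVec_swap_add (c : Colour) (x : Bool) :
    basisVec c.swap false x + basisVec c.swap true x = (Real.sqrt 2 : ℂ) * basisVec c false x := by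
  have := sqrt_two_ne_zero
  have := sqrt_two_sq
  cases c <;> cases x <;> simp [basisVec, minusCoeff, Colour.swap] <;> grind

/-- The entry of a spider with phase factor `e` and legs `A`. -/
noncomputable def spiderWeight (c : Colour) (e : ℂ) (A : Multiset ℕ) (b : ℕ → Bool) : ℂ :=
  (A.map fun w => basisVec c false (b w)).prod + e * (A.map fun w => basisVec c true (b w)).prod

section

variable {𝒱 : Type u}

/-- The tensor entry of a vertex under a valuation. -/
noncomputable def weight (v : 𝒱 → Bool) (x : Vertex 𝒱) (b : ℕ → Bool) : ℂ :=
  (x.instantiate v).entry b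

/-- The product of the tensor entries of several vertices under a valuation. -/
noncomputable def amplitude (v : 𝒱 → Bool) (V : Multiset (Vertex 𝒱)) (b : ℕ → Bool) : ℂ :=
  (V.map fun x => weight v x b).prod

/-- Both colours take the same form over their own basis, so the rules can mostly be proved for an
arbitrary colour. -/
theorem weight_spider (v : 𝒱 → Bool) (c : Colour) (α : Real.Angle) (U : Finset 𝒱)
    (A : Multiset ℕ) (b : ℕ → Bool) :
    weight v (.spider c α U A) b = spiderWeight c (expI (angleAt v α U)) A b := by
  have h0 : ∀ x : Bool, (if x then (0 : ℂ) else 1) = basisVec .Z false x := by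
    intro x
    cases x <;> simp [basisVec]
  have h1 : ∀ x : Bool, (if x then (1 : ℂ) else 0) = basisVec .Z true x := by
    intro x
    cases x <;> simp [basisVec]
  cases c
  · simp only [weight, Vertex.instantiate, Vertex.entry, spiderWeight, h0, h1]
  · simp [weight, Vertex.instantiate, Vertex.entry, spiderWeight, basisVec]

theorem weight_hadamard (v : 𝒱 → Bool) (a k : ℕ) (b : ℕ → Bool) :
    weight v (.hadamard {a, k}) b = hadamardEntry (b a) (b k) := by
  simp [weight, Vertex.instantiate, Vertex.entry, hadamardEntry]

theorem weight_spider_zero (v : 𝒱 → Bool) (c : Colour) (A : Multiset ℕ) (b : ℕ → Bool) :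
    weight v (.spider c 0 ∅ A) b = spiderWeight c 1 A b := by
  simp [weight_spider, angleAt, expI_zero]

theorem spiderWeight_pair (c : Colour) (e : ℂ) (a k : ℕ) (b : ℕ → Bool) :
    spiderWeight c e {a, k} b = twoLegs c e (b a) (b k) := by
  simp [spiderWeight, twoLegs]

theorem amplitude_zero (v : 𝒱 → Bool) (b : ℕ → Bool) : amplitude v 0 b = 1 := by
  simp [amplitude]

theorem amplitude_cons (v : 𝒱 → Bool) (x : Vertex 𝒱) (V : Multiset (Vertex 𝒱)) (b : ℕ → Bool) :
    amplitude v (x ::ₘ V) b = weight v x b * amplitude v V b := by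
  simp [amplitude]

theorem amplitude_singleton (v : 𝒱 → Bool) (x : Vertex 𝒱) (b : ℕ → Bool) :
    amplitude v {x} b = weight v x b := by
  simp [amplitude]

theorem amplitude_add (v : 𝒱 → Bool) (V W : Multiset (Vertex 𝒱)) (b : ℕ → Bool) :
    amplitude v (V + W) b = amplitude v V b * amplitude v W b := by
  simp [amplitude]

theorem weight_dependsOn (v : 𝒱 → Bool) (x : Vertex 𝒱) :
    DependsOn (weight v x) {w | w ∈ x.legs} := fun b b' h => by
  cases x with
  | spider c α U A =>
    have h' : ∀ w ∈ A, b w = b' w := h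
    have e : ∀ j, (A.map fun w => basisVec c j (b w)) = A.map fun w => basisVec c j (b' w) :=
      fun j => Multiset.map_congr rfl fun w hw => by rw [h' w hw]
    simp only [weight_spider, spiderWeight, e]
  | hadamard A =>
    have h' : ∀ w ∈ A, b w = b' w := h
    have : (∀ w ∈ A, b w = true) ↔ ∀ w ∈ A, b' w = true :=
      forall₂_congr fun w hw => by rw [h' w hw]
    simp only [weight, Vertex.instantiate, Vertex.entry, this]

theorem amplitude_dependsOn (v : 𝒱 → Bool) (V : Multiset (Vertex 𝒱)) :
    DependsOn (amplitude v V) {w | w ∈ V.bind Vertex.legs} :=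
  dependsOn_multiset_prod fun x hx => (weight_dependsOn v x).mono fun _ hw =>
    Multiset.mem_bind.2 ⟨x, hx, hw⟩

theorem weight_rename (v : 𝒱 → Bool) (f : ℕ → ℕ) (x : Vertex 𝒱) (b : ℕ → Bool) :
    weight v (x.rename f) b = weight v x (b ∘ f) := by
  cases x with
  | spider c α U A => simp [Vertex.rename, weight_spider, spiderWeight]
  | hadamard A => simp [Vertex.rename, weight, Vertex.instantiate, Vertex.entry]

theorem amplitude_rename (v : 𝒱 → Bool) (f : ℕ → ℕ) (V : Multiset (Vertex 𝒱)) (b : ℕ → Bool) :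
    amplitude v (V.map (Vertex.rename f)) b = amplitude v V (b ∘ f) := by
  simp [amplitude, weight_rename]

theorem legs_rename (f : ℕ → ℕ) (x : Vertex 𝒱) : (x.rename f).legs = x.legs.map f := by
  cases x <;> rfl

theorem legs_instantiate (v : 𝒱 → Bool) (x : Vertex 𝒱) : (x.instantiate v).legs = x.legs := by
  cases x <;> rfl

theorem ends_rename (f : ℕ → ℕ) (D : PreDiagram 𝒱) : (D.rename f).ends = D.ends.map f := by
  simp [PreDiagram.ends, PreDiagram.rename, Multiset.map_bind, Multiset.bind_map, legs_rename]

theorem ends_instantiate (v : 𝒱 → Bool) (D : PreDiagram 𝒱) : (D.instantiate v).ends = D.ends := by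
  simp [PreDiagram.ends, PreDiagram.instantiate, Multiset.bind_map, legs_instantiate]

/-- The condition that the inputs and outputs of a diagram carry given basis states. -/
noncomputable def boundary (ins outs : List ℕ) (x y : List Bool) (b : ℕ → Bool) : ℂ :=
  if ins.map b = x ∧ outs.map b = y then 1 else 0

theorem boundary_dependsOn (ins outs : List ℕ) (x y : List Bool) :
    DependsOn (boundary ins outs x y) {w | w ∈ ins ∨ w ∈ outs} := fun b b' h => by
  have h1 : ins.map b = ins.map b' := List.map_congr_left fun w hw => h w (Or.inl hw)
  have h2 : outs.map b = outs.map b' := List.map_congr_left fun w hw => h w (Or.inr hw)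
  rw [boundary, boundary, h1, h2]

theorem denote_instantiate (D : PreDiagram 𝒱) (v : 𝒱 → Bool) (x y : List Bool) :
    (D.instantiate v).denote x y = sumWires D.ends.toFinset.val
      (fun b => boundary D.inputs D.outputs x y b * amplitude v D.vertices b) fun _ => false := by
  rw [PreDiagram.denote, ends_instantiate, ← sum_powerset_eq_sumWires]
  refine Finset.sum_congr rfl fun T _ => ?_
  simp [PreDiagram.instantiate, boundary, amplitude, weight]

end

/-! ### Soundness of the local rules -/

section

variable {𝒱 : Type u}

theorem spiderWeight_add (c : Colour) (e : ℂ) (A B : Multiset ℕ) :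
    spiderWeight c e (A + B) = fun b =>
      (A.map fun w => basisVec c false (b w)).prod * (B.map fun w => basisVec c false (b w)).prod +
        e * ((A.map fun w => basisVec c true (b w)).prod *
          (B.map fun w => basisVec c true (b w)).prod) := by
  funext b
  simp only [spiderWeight, Multiset.map_add, Multiset.prod_add]

/-- The connecting wires contribute independently, each one the same inner product. -/
theorem sumWires_basisVec_mul (c c' : Colour) (i j : Bool) {K : Multiset ℕ} (hK : K.Nodup)
    (b : ℕ → Bool) :
    sumWires K (fun b => (K.map fun w => basisVec c i (b w)).prod *
      (K.map fun w => basisVec c' j (b w)).prod) b =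
      (basisVec c i false * basisVec c' j false +
        basisVec c i true * basisVec c' j true) ^ K.card := by
  have h := sumWires_prod K id (fun _ x _ => basisVec c i x * basisVec c' j x) (by simpa using hK)
    (fun _ _ _ _ _ _ => rfl) b
  simpa [Multiset.prod_map_mul] using h

/-- At least one wire is needed: for `K = 0` the value would be `1` also when `i ≠ j`, as
unconnected spiders do not merge. -/
theorem sumWires_basisVec_mul_same (c : Colour) (i j : Bool) {K : Multiset ℕ} (hK : K.Nodup)
    (h0 : K ≠ 0) (b : ℕ → Bool) :
    sumWires K (fun b => (K.map fun w => basisVec c i (b w)).prod *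
      (K.map fun w => basisVec c j (b w)).prod) b = if i = j then 1 else 0 := by
  rw [sumWires_basisVec_mul _ _ _ _ hK, basisVec_orthonormal]
  have : K.card ≠ 0 := by simpa using h0
  split_ifs <;> simp [this]

/-- Spiders of one colour joined by wires merge. -/
theorem sumWires_spider_mul_spider (c : Colour) (e f : ℂ) {A B K : Multiset ℕ} (hK : K.Nodup)
    (h0 : K ≠ 0) (hA : ∀ w ∈ K, w ∉ A) (hB : ∀ w ∈ K, w ∉ B) (b : ℕ → Bool) :
    sumWires K (fun b => spiderWeight c e (A + K) b * spiderWeight c f (B + K) b) b =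
      spiderWeight c (e * f) (A + B) b := by
  simp only [spiderWeight_add]
  rw [sumWires_mul_expand (dependsOn_legs hA _) (dependsOn_legs hA _) (dependsOn_legs hB _)
    (dependsOn_legs hB _)]
  -- Of the four terms, the two mixed ones vanish by orthogonality.
  simp only [sumWires_basisVec_mul_same c _ _ hK h0]
  simp

/-- Two wires between spiders of different colours can be cut. -/
theorem sumWires_spider_mul_spider_swap (c : Colour) (e f : ℂ) {A B : Multiset ℕ} {a k : ℕ}
    (hK : ({a, k} : Multiset ℕ).Nodup) (hA : ∀ w ∈ ({a, k} : Multiset ℕ), w ∉ A)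
    (hB : ∀ w ∈ ({a, k} : Multiset ℕ), w ∉ B) (b : ℕ → Bool) :
    sumWires {a, k} (fun b => spiderWeight c e (A + {a, k}) b *
      spiderWeight c.swap f (B + {a, k}) b) b =
      1 / 2 * (spiderWeight c e A b * spiderWeight c.swap f B b) := by
  simp only [spiderWeight_add]
  rw [sumWires_mul_expand (dependsOn_legs hA _) (dependsOn_legs hA _) (dependsOn_legs hB _)
    (dependsOn_legs hB _)]
  -- Two wires square the overlap, which removes its sign. All four terms then get the same
  -- coefficient and the product factorises again.
  have h : ∀ i j, hadamardEntry i j ^ Multiset.card ({a, k} : Multiset ℕ) = 1 / 2 := by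
    intro i j
    rw [show Multiset.card ({a, k} : Multiset ℕ) = 2 from rfl, hadamardEntry, div_pow, sqrt_two_sq]
    split_ifs <;> norm_num
  simp only [sumWires_basisVec_mul _ _ _ _ hK, basisVec_overlap, h, spiderWeight]
  ring

/-- A spider with a matrix on each of several legs. -/
theorem sumWires_spider_mul_prod (c : Colour) (e : ℂ) (g : Bool → Bool → ℂ)
    {P : Multiset (ℕ × ℕ)} {B : Multiset ℕ} (hP : (P.map Prod.snd).Nodup)
    (hfst : ∀ w ∈ P.map Prod.snd, w ∉ P.map Prod.fst) (hB : ∀ w ∈ P.map Prod.snd, w ∉ B)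
    (b : ℕ → Bool) :
    sumWires (P.map Prod.snd) (fun b => spiderWeight c e (B + P.map Prod.snd) b *
      (P.map fun p => g (b p.1) (b p.2)).prod) b =
      (B.map fun w => basisVec c false (b w)).prod * (P.map fun p =>
        basisVec c false false * g (b p.1) false + basisVec c false true * g (b p.1) true).prod +
      e * ((B.map fun w => basisVec c true (b w)).prod * (P.map fun p =>
        basisVec c true false * g (b p.1) false + basisVec c true true * g (b p.1) true).prod) := by
  have key : ∀ j, sumWires (P.map Prod.snd) (fun b =>
      (P.map fun p => basisVec c j (b p.2) * g (b p.1) (b p.2)).prod) b =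
      (P.map fun p =>
        basisVec c j false * g (b p.1) false + basisVec c j true * g (b p.1) true).prod := by
    intro j
    refine sumWires_prod P Prod.snd (fun p x b => basisVec c j x * g (b p.1) x) hP ?_ b
    intro p hp x b b' h
    have : b p.1 = b' p.1 := h p.1 fun h' => hfst _ h' (Multiset.mem_map_of_mem _ hp)
    simp only [this]
  rw [← key, ← key, ← sumWires_mul_left (dependsOn_legs hB _),
    ← sumWires_mul_left (dependsOn_legs hB _), ← sumWires_const_mul, ← sumWires_fun_add]
  congr 1
  funext b
  simp only [spiderWeight_add, Multiset.map_map, Function.comp_def, Multiset.prod_map_mul]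
  ring

theorem bind_pair (P : Multiset (ℕ × ℕ)) :
    (P.bind fun p => ({p.1, p.2} : Multiset ℕ)) = P.map Prod.fst + P.map Prod.snd := by
  simp_rw [Multiset.insert_eq_cons, ← Multiset.singleton_add, Multiset.bind_add,
    Multiset.bind_singleton]

/-- The two sides of a rule have the same open wires, and their amplitudes agree, up to a factor
whose modulus does not depend on the valuation, after summation over the internal wires. -/
def SoundRule (L R : Multiset (Vertex 𝒱)) : Prop :=
  ∃ O I J : Multiset ℕ, L.bind Vertex.legs = O + (I + I) ∧ R.bind Vertex.legs = O + (J + J) ∧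
    (I.Nodup → (∀ w ∈ I, w ∉ O) → J.Nodup → (∀ w ∈ J, w ∉ O) →
      ∃ (k : (𝒱 → Bool) → ℂ) (r : ℝ), 0 < r ∧ (∀ v, ‖k v‖ = r) ∧
        ∀ v b, sumWires I (amplitude v L) b = k v * sumWires J (amplitude v R) b)

/-- A factor that does not depend on the valuation. -/
theorem exists_factor_of_const {k : ℂ} (hk : k ≠ 0) {F G : (𝒱 → Bool) → (ℕ → Bool) → ℂ}
    (h : ∀ v b, F v b = k * G v b) :
    ∃ (k : (𝒱 → Bool) → ℂ) (r : ℝ), 0 < r ∧ (∀ v, ‖k v‖ = r) ∧ ∀ v b, F v b = k v * G v b :=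
  ⟨fun _ => k, ‖k‖, norm_pos_iff.2 hk, fun _ => rfl, h⟩

theorem soundRule_spider (c : Colour) (α β γ : Real.Angle) (U V W : Finset 𝒱) (A B K : Multiset ℕ)
    (hK : K ≠ 0) (h : ∀ v, angleAt v α U + angleAt v β V = angleAt v γ W) :
    SoundRule {.spider c α U (A + K), .spider c β V (B + K)} {.spider c γ W (A + B)} := by
  refine ⟨A + B, K, 0, ?_, ?_, fun hI hdisj _ _ => exists_factor_of_const one_ne_zero ?_⟩
  · simp [Vertex.legs]
    abel
  · simp [Vertex.legs]
  · intro v b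
    have hA : ∀ w ∈ K, w ∉ A := fun w hw h' => hdisj w hw (Multiset.mem_add.2 (Or.inl h'))
    have hB : ∀ w ∈ K, w ∉ B := fun w hw h' => hdisj w hw (Multiset.mem_add.2 (Or.inr h'))
    have hL : amplitude v {.spider c α U (A + K), .spider c β V (B + K)} = fun b =>
        spiderWeight c (expI (angleAt v α U)) (A + K) b *
          spiderWeight c (expI (angleAt v β V)) (B + K) b := by
      funext b
      simp [amplitude, weight_spider]
    rw [hL, sumWires_spider_mul_spider c _ _ hI hK hA hB, ← expI_add, h]
    simp [amplitude, weight_spider]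

/-- Both sides fuse to the same spider, whose phase is symmetric in the two labels. -/
theorem soundRule_commute (c : Colour) (α β : Real.Angle) (U V : Finset 𝒱) (A B K : Multiset ℕ)
    (hK : K ≠ 0) :
    SoundRule {.spider c α U (A + K), .spider c β V (B + K)}
      {.spider c β V (A + K), .spider c α U (B + K)} := by
  refine ⟨A + B, K, K, ?_, ?_, fun hI hdisj _ _ => exists_factor_of_const one_ne_zero ?_⟩
  · simp [Vertex.legs]
    abel
  · simp [Vertex.legs]
    abel
  · intro v b
    have hA : ∀ w ∈ K, w ∉ A := fun w hw h' => hdisj w hw (Multiset.mem_add.2 (Or.inl h'))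
    have hB : ∀ w ∈ K, w ∉ B := fun w hw h' => hdisj w hw (Multiset.mem_add.2 (Or.inr h'))
    have hL : ∀ (α β : Real.Angle) (U V : Finset 𝒱),
        amplitude v {.spider c α U (A + K), .spider c β V (B + K)} = fun b =>
        spiderWeight c (expI (angleAt v α U)) (A + K) b *
          spiderWeight c (expI (angleAt v β V)) (B + K) b := by
      intro α β U V
      funext b
      simp [amplitude, weight_spider]
    rw [hL, hL, sumWires_spider_mul_spider c _ _ hI hK hA hB,
      sumWires_spider_mul_spider c _ _ hI hK hA hB, mul_comm (expI _), one_mul]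

/-- Summing over the loop multiplies each of the two terms of the spider by the squared norm of a
basis vector, which is `1`. -/
theorem soundRule_antiLoop (c : Colour) (α : Real.Angle) (U : Finset 𝒱) (a : ℕ) (A : Multiset ℕ) :
    SoundRule {.spider c α U (A + {a, a})} {.spider c α U A} := by
  refine ⟨A, {a}, 0, ?_, ?_, fun hI hdisj _ _ => exists_factor_of_const one_ne_zero ?_⟩
  · simp [Vertex.legs]
  · simp [Vertex.legs]
  · intro v b
    have hL : amplitude v {.spider c α U (A + {a, a})} = fun b =>
        (A.map fun w => basisVec c false (b w)).prod *
          (basisVec c false (b a) * basisVec c false (b a)) +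
        expI (angleAt v α U) * ((A.map fun w => basisVec c true (b w)).prod *
          (basisVec c true (b a) * basisVec c true (b a))) := by
      funext b
      simp [amplitude, weight_spider, spiderWeight_add, -Multiset.insert_eq_cons]
      simp
    rw [hL, sumWires_fun_add, sumWires_const_mul, sumWires_mul_left (dependsOn_legs hdisj _),
      sumWires_mul_left (dependsOn_legs hdisj _)]
    simp [sumWire, basisVec_orthonormal, amplitude, weight_spider, spiderWeight]

theorem soundRule_hopf (c : Colour) (α β : Real.Angle) (U V : Finset 𝒱) (a b : ℕ)
    (A B : Multiset ℕ) :
    SoundRule {.spider c α U (A + {a, b}), .spider c.swap β V (B + {a, b})}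
      {.spider c α U A, .spider c.swap β V B} := by
  refine ⟨A + B, {a, b}, 0, ?_, ?_, fun hI hdisj _ _ => exists_factor_of_const
    (k := 1 / 2) (by norm_num) ?_⟩
  · simp only [Multiset.insert_eq_cons, Multiset.cons_bind, Multiset.singleton_bind, Vertex.legs]
    abel
  · simp [Vertex.legs]
  · intro v x
    have hA : ∀ w ∈ ({a, b} : Multiset ℕ), w ∉ A := fun w hw h' =>
      hdisj w hw (Multiset.mem_add.2 (Or.inl h'))
    have hB : ∀ w ∈ ({a, b} : Multiset ℕ), w ∉ B := fun w hw h' =>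
      hdisj w hw (Multiset.mem_add.2 (Or.inr h'))
    have hL : amplitude v {.spider c α U (A + {a, b}), .spider c.swap β V (B + {a, b})} = fun x =>
        spiderWeight c (expI (angleAt v α U)) (A + {a, b}) x *
          spiderWeight c.swap (expI (angleAt v β V)) (B + {a, b}) x := by
      funext x
      simp [amplitude, weight_spider]
    rw [hL, sumWires_spider_mul_spider_swap c _ _ hI hA hB]
    simp [amplitude, weight_spider]

theorem soundRule_copying (c : Colour) (a : ℕ) (A : Multiset ℕ) :
    SoundRule (𝒱 := 𝒱) {.spider c.swap 0 ∅ {a}, .spider c 0 ∅ (A + {a})}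
      (A.map fun b => .spider c.swap 0 ∅ {b}) := by
  -- The numerator comes from the leaf on the left, the denominator from its `A.card` copies on the
  -- right.
  refine ⟨A, {a}, 0, ?_, ?_, fun hI hdisj _ _ => exists_factor_of_const
    (k := Real.sqrt 2 / (Real.sqrt 2) ^ A.card) (by simp) ?_⟩
  · simp only [Multiset.insert_eq_cons, Multiset.cons_bind, Multiset.singleton_bind, Vertex.legs]
    abel
  · simp only [Multiset.bind_map, Vertex.legs, add_zero]
    exact (Multiset.bind_singleton A fun x => x).trans (Multiset.map_id' A)
  · intro v x
    have hL : amplitude v ({.spider c.swap 0 ∅ {a}, .spider c 0 ∅ (A + {a})} :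
        Multiset (Vertex 𝒱)) = fun b =>
        (A.map fun w => basisVec c false (b w)).prod *
          (Real.sqrt 2 * (basisVec c false (b a) * basisVec c false (b a))) +
        1 * ((A.map fun w => basisVec c true (b w)).prod *
          (Real.sqrt 2 * (basisVec c false (b a) * basisVec c true (b a)))) := by
      funext b
      have := basisVec_swap_add c (b a)
      simp only [amplitude, Multiset.insert_eq_cons, Multiset.map_cons, Multiset.map_singleton,
        Multiset.prod_cons, Multiset.prod_singleton, weight_spider_zero, spiderWeight_add]
      simp only [spiderWeight, Multiset.map_singleton, Multiset.prod_singleton, one_mul, this]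
      ring
    rw [hL, sumWires_fun_add, sumWires_const_mul, sumWires_mul_left (dependsOn_legs hdisj _),
      sumWires_mul_left (dependsOn_legs hdisj _), sumWires_const_mul, sumWires_const_mul]
    have h2 : (Real.sqrt 2 : ℂ) ^ A.card ≠ 0 := pow_ne_zero _ sqrt_two_ne_zero
    simp [sumWire, basisVec_orthonormal, amplitude, weight_spider_zero, spiderWeight,
      basisVec_swap_add, Multiset.prod_map_mul]
    field_simp

/-- The Hadamard matrix on a leg turns vector `j` of one basis into vector `j` of the other, in both
terms of the spider. -/
theorem soundRule_hCommute (c : Colour) (α : Real.Angle) (U : Finset 𝒱) (P : Multiset (ℕ × ℕ)) :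
    SoundRule (.spider c α U (P.map Prod.snd) ::ₘ P.map fun p => .hadamard {p.1, p.2})
      {.spider c.swap α U (P.map Prod.fst)} := by
  refine ⟨P.map Prod.fst, P.map Prod.snd, 0, ?_, ?_, fun hI hdisj _ _ =>
    exists_factor_of_const one_ne_zero ?_⟩
  · simp only [Multiset.cons_bind, Multiset.bind_map, Vertex.legs, bind_pair]
    abel
  · simp [Vertex.legs]
  · intro v b
    have hL : amplitude v
        (.spider c α U (P.map Prod.snd) ::ₘ P.map fun p => .hadamard {p.1, p.2}) = fun b =>
        spiderWeight c (expI (angleAt v α U)) (0 + P.map Prod.snd) b *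
          (P.map fun p => hadamardEntry (b p.1) (b p.2)).prod := by
      funext b
      simp [amplitude, weight_spider, weight_hadamard, -Multiset.insert_eq_cons]
    rw [hL, sumWires_spider_mul_prod c _ _ hI hdisj (by simp)]
    simp [basisVec_mul_hadamardEntry, amplitude, weight_spider, spiderWeight]

open Classical in
theorem expI_angleAt_pi (v : 𝒱 → Bool) (U : Finset 𝒱) :
    expI (angleAt v (Real.pi : ℝ) U) = if Active v U then -1 else 1 := by
  rw [angleAt]
  split_ifs
  · exact expI_pi
  · exact expI_zero

/-- An active π exchanges the two basis vectors, so the phase `e^{iα}` moves from one term of the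
spider to the other. Taking it out as a common factor leaves `e^{-iα}` on the opposite term, that is
the negated angle. The factor depends on the valuation, but its modulus is always `1`. -/
theorem soundRule_piCommute (c : Colour) (α β : Real.Angle) (U V W : Finset 𝒱) (a b : ℕ)
    (P : Multiset (ℕ × ℕ))
    (h : ∀ v, (Active v U → angleAt v β W = -angleAt v α V) ∧
      (¬ Active v U → angleAt v β W = angleAt v α V)) :
    SoundRule {.spider c.swap (Real.pi : ℝ) U {a, b}, .spider c α V (P.map Prod.fst + {b})}
      (.spider c β W (P.map Prod.snd + {a}) ::ₘ
        P.map fun p => .spider c.swap (Real.pi : ℝ) U {p.1, p.2}) := by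
  classical
  refine ⟨P.map Prod.fst + {a}, {b}, P.map Prod.snd, ?_, ?_, fun hI hdisj hJ hdisjR =>
    ⟨fun v => if Active v U then expI (angleAt v α V) else 1, 1, one_pos, ?_, ?_⟩⟩
  · simp only [Multiset.insert_eq_cons, Multiset.cons_bind, Multiset.singleton_bind, Vertex.legs]
    simp only [← Multiset.singleton_add]
    abel
  · simp only [Multiset.cons_bind, Multiset.bind_map, Vertex.legs, bind_pair]
    abel
  · intro v
    dsimp only
    split_ifs <;> simp [norm_expI]
  · intro v x
    set e := expI (angleAt v (Real.pi : ℝ) U) with he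
    -- The left side is viewed as a spider with a matrix on the single leg `b`, so that
    -- `sumWires_spider_mul_prod` evaluates both sides.
    have hL : amplitude v
        {.spider c.swap (Real.pi : ℝ) U {a, b}, .spider c α V (P.map Prod.fst + {b})} = fun x =>
        spiderWeight c (expI (angleAt v α V)) (P.map Prod.fst + Multiset.map Prod.snd {(a, b)}) x *
          (Multiset.map (fun p : ℕ × ℕ => twoLegs c.swap e (x p.1) (x p.2)) {(a, b)}).prod := by
      funext x
      simp only [amplitude, weight_spider, Multiset.insert_eq_cons, Multiset.map_cons,
        Multiset.map_singleton, Multiset.prod_cons, Multiset.prod_singleton]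
      rw [← Multiset.insert_eq_cons, spiderWeight_pair, mul_comm]
    have hR : amplitude v (.spider c β W (P.map Prod.snd + {a}) ::ₘ
        P.map fun p => .spider c.swap (Real.pi : ℝ) U {p.1, p.2}) = fun x =>
        spiderWeight c (expI (angleAt v β W)) ({a} + P.map Prod.snd) x *
          (P.map fun p => twoLegs c.swap e (x p.1) (x p.2)).prod := by
      funext x
      simp [amplitude, weight_spider, spiderWeight_pair, add_comm, e,
        -Multiset.insert_eq_cons, -Multiset.singleton_add]
    have hL' := sumWires_spider_mul_prod c (expI (angleAt v α V)) (twoLegs c.swap e)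
      (P := {(a, b)}) (B := P.map Prod.fst) (by simp)
      (by simpa using fun e => hdisj b (by simp) (by simp [e]))
      (fun w hw h' => hdisj w (by simpa using hw) (Multiset.mem_add.2 (Or.inl h'))) x
    rw [Multiset.map_singleton (f := Prod.snd)] at hL'
    rw [hL, hR, Multiset.map_singleton (f := Prod.snd), hL', sumWires_spider_mul_prod c _ _ hJ
      (fun w hw h' => hdisjR w hw (Multiset.mem_add.2 (Or.inl h')))
      (fun w hw h' => hdisjR w hw (Multiset.mem_add.2 (Or.inr h')))]
    rw [expI_angleAt_pi] at he
    dsimp only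
    by_cases hU : Active v U
    · rw [if_pos hU] at he ⊢
      have := expI_mul_expI_neg (angleAt v α V)
      rw [he, (h v).1 hU]
      simp [basisVec_mul_twoLegs_neg_one]
      grind
    · rw [if_neg hU] at he ⊢
      rw [he, (h v).2 hU]
      simp [basisVec_mul_twoLegs_one, mul_comm]

/-- The entry of an unlabelled spider of degree three. -/
noncomputable def threeLegs : Colour → Bool → Bool → Bool → ℂ
  | .Z, p, q, r => if p = q ∧ q = r then 1 else 0
  | .X, p, q, r => if (p ^^ q ^^ r) then 0 else (Real.sqrt 2 : ℂ)⁻¹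

/-- For `X` the entry is `(1 + (-1)^{p+q+r}) / √8`, a multiple of the indicator of even parity; for
`Z` it is the indicator of equality. -/
theorem spiderWeight_triple (c : Colour) (p q r : ℕ) (b : ℕ → Bool) :
    spiderWeight c 1 {p, q, r} b = threeLegs c (b p) (b q) (b r) := by
  have := inv_sqrt_two_sq
  cases c <;> cases hp : b p <;> cases hq : b q <;> cases hr : b r <;>
    simp [spiderWeight, threeLegs, basisVec, minusCoeff, hp, hq, hr] <;> grind

/-- For `c = Z`, the equality tensors force `i = j = p` and `k = l = q`, and the parity tensors then
require `s = p + q = t` modulo 2. The right side imposes the same condition through its one internal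
bit. For `c = X` the roles of inputs and outputs are exchanged. -/
theorem bialgebra_sum (c : Colour) (p q s t : Bool) :
    ∑ i : Bool, ∑ j : Bool, ∑ k : Bool, ∑ l : Bool,
      threeLegs c p i j * (threeLegs c q k l * (threeLegs c.swap s i k * threeLegs c.swap t j l)) =
    1 / Real.sqrt 2 * ∑ i : Bool, threeLegs c.swap p q i * threeLegs c i s t := by
  cases c <;> cases p <;> cases q <;> cases s <;> cases t <;>
    simp [threeLegs, Colour.swap]

theorem soundRule_bialgebra (c : Colour) (x₁ x₂ y₁ y₂ k₁₁ k₁₂ k₂₁ k₂₂ k : ℕ) :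
    SoundRule (𝒱 := 𝒱)
      {.spider c 0 ∅ {x₁, k₁₁, k₁₂}, .spider c 0 ∅ {x₂, k₂₁, k₂₂},
        .spider c.swap 0 ∅ {y₁, k₁₁, k₂₁}, .spider c.swap 0 ∅ {y₂, k₁₂, k₂₂}}
      {.spider c.swap 0 ∅ {x₁, x₂, k}, .spider c 0 ∅ {k, y₁, y₂}} := by
  refine ⟨{x₁, x₂, y₁, y₂}, {k₁₁, k₁₂, k₂₁, k₂₂}, {k}, ?_, ?_, fun hI hdisj hJ hdisjR =>
    exists_factor_of_const (k := 1 / Real.sqrt 2) (by simp) ?_⟩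
  · simp only [Multiset.insert_eq_cons, Multiset.cons_bind, Multiset.singleton_bind, Vertex.legs]
    simp only [← Multiset.singleton_add]
    abel
  · simp only [Multiset.insert_eq_cons, Multiset.cons_bind, Multiset.singleton_bind, Vertex.legs]
    simp only [← Multiset.singleton_add]
    abel
  · intro v b
    have hN : k₁₁ ≠ k₁₂ ∧ k₁₁ ≠ k₂₁ ∧ k₁₁ ≠ k₂₂ ∧ k₁₂ ≠ k₂₁ ∧ k₁₂ ≠ k₂₂ ∧ k₂₁ ≠ k₂₂ := by
      simpa [and_assoc] using hI
    obtain ⟨h1, h2, h3, h4, h5, h6⟩ := hN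
    have hx : ∀ w ∈ ({x₁, x₂, y₁, y₂} : Multiset ℕ),
        w ≠ k₁₁ ∧ w ≠ k₁₂ ∧ w ≠ k₂₁ ∧ w ≠ k₂₂ ∧ w ≠ k := fun w hw =>
      ⟨fun e => hdisj k₁₁ (by simp) (e ▸ hw), fun e => hdisj k₁₂ (by simp) (e ▸ hw),
        fun e => hdisj k₂₁ (by simp) (e ▸ hw), fun e => hdisj k₂₂ (by simp) (e ▸ hw),
        fun e => hdisjR k (by simp) (e ▸ hw)⟩
    obtain ⟨a1, a2, a3, a4, a5⟩ := hx x₁ (by simp)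
    obtain ⟨b1, b2, b3, b4, b5⟩ := hx x₂ (by simp)
    obtain ⟨c1, c2, c3, c4, c5⟩ := hx y₁ (by simp)
    obtain ⟨d1, d2, d3, d4, d5⟩ := hx y₂ (by simp)
    have h := bialgebra_sum c (b x₁) (b x₂) (b y₁) (b y₂)
    simp only [Fintype.sum_bool] at h
    simp only [Multiset.insert_eq_cons, sumWires_cons, sumWires_singleton, sumWire, amplitude,
      Multiset.map_cons, Multiset.map_singleton, Multiset.prod_cons, Multiset.prod_singleton,
      weight_spider_zero]
    simp only [← Multiset.insert_eq_cons, spiderWeight_triple, Function.update_self, ne_eq,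
      not_false_eq_true, Function.update_of_ne, h1, h2, h3, h4, h5, h6, a1, a2, a3, a4, a5,
      b1, b2, b3, b4, b5, c1, c2, c3, c4, c5, d1, d2, d3, d4, d5]
    linear_combination h

theorem LocalRule.soundRule {L R : Multiset (Vertex 𝒱)} (h : LocalRule L R) : SoundRule L R := by
  cases h with
  | spider c α β γ U V W A B K hK h => exact soundRule_spider c α β γ U V W A B K hK h
  | antiLoop c α U a A => exact soundRule_antiLoop c α U a A
  | commute c α β U V A B K hK => exact soundRule_commute c α β U V A B K hK
  | copying c a A => exact soundRule_copying c a A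
  | piCommute c α β U V W a b P h => exact soundRule_piCommute c α β U V W a b P h
  | bialgebra c x₁ x₂ y₁ y₂ k₁₁ k₁₂ k₂₁ k₂₂ k =>
    exact soundRule_bialgebra c x₁ x₂ y₁ y₂ k₁₁ k₁₂ k₂₁ k₂₂ k
  | hopf c α β U V a b A B => exact soundRule_hopf c α β U V a b A B
  | hCommute c α U P => exact soundRule_hCommute c α U P
  | scalar K hin hout r hr h =>
    -- All wires of a closed diagram are internal, and having two ends each they make up `I + I`.
    -- The factor is the value of `K` itself.
    set I := K.ends.toFinset.val with hI
    have hends : K.vertices.bind Vertex.legs = K.ends := by simp [PreDiagram.ends, hin, hout]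
    refine ⟨0, I, 0, ?_, by simp, fun hI _ _ _ =>
      ⟨fun v => (K.toPreDiagram.instantiate v).denote [] [], r, hr, h, fun v b => ?_⟩⟩
    · rw [hends, zero_add]
      ext w
      by_cases hw : w ∈ K.ends
      · simp [hI, K.two_ends w hw, hw]
      · simp [hI, hw]
    · dsimp only
      rw [denote_instantiate]
      simp only [hin, hout, boundary, List.map_nil, and_self, if_true, one_mul, amplitude_zero,
        sumWires_zero, mul_one]
      -- The closed sum is constant, so its value at `b` is its value at the all-`false` assignment
      -- used by the interpretation.
      refine dependsOn_sumWires (s := ∅) ((amplitude_dependsOn v _).mono fun w hw => Or.inr ?_)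
        fun _ h' => absurd h' (Set.notMem_empty _)
      rw [Set.mem_ofPred_eq, hends] at hw
      exact Multiset.mem_toFinset.2 hw

end

/-! ### Soundness of rewriting -/

section

variable {𝒱 : Type u}

/-- The interpretations of two diagrams agree in all valuations, up to a factor whose modulus does
not depend on the valuation. -/
def Proportional (D D' : PreDiagram 𝒱) : Prop :=
  ∃ (k : (𝒱 → Bool) → ℂ) (r : ℝ), 0 < r ∧ (∀ v, ‖k v‖ = r) ∧
    ∀ v x y, (D.instantiate v).denote x y = k v * (D'.instantiate v).denote x y

theorem Proportional.of_eq {D D' : PreDiagram 𝒱}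
    (h : ∀ v x y, (D.instantiate v).denote x y = (D'.instantiate v).denote x y) :
    Proportional D D' :=
  ⟨fun _ => 1, 1, one_pos, by simp, by simpa using h⟩

theorem Proportional.symm {D D' : PreDiagram 𝒱} (h : Proportional D D') : Proportional D' D := by
  obtain ⟨k, r, hr, hk, h⟩ := h
  refine ⟨fun v => (k v)⁻¹, r⁻¹, inv_pos.2 hr, fun v => by simp [hk], fun v x y => ?_⟩
  have : k v ≠ 0 := norm_pos_iff.1 (by rw [hk]; exact hr)
  rw [h, inv_mul_cancel_left₀ this]

theorem Proportional.trans {D D' D'' : PreDiagram 𝒱} (h : Proportional D D')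
    (h' : Proportional D' D'') : Proportional D D'' := by
  obtain ⟨k, r, hr, hk, h⟩ := h
  obtain ⟨k', r', hr', hk', h'⟩ := h'
  exact ⟨fun v => k v * k' v, r * r', mul_pos hr hr', fun v => by simp [hk, hk'],
    fun v x y => by rw [h, h', mul_assoc]⟩

/-- A wire of `I` already has two ends there, which exhausts its multiplicity. The freshness
conditions in `SoundRule` are thus automatic for rewrites between diagrams. -/
theorem internal_of_two_ends {M I E : Multiset ℕ} (hE : E = M + (I + I))
    (h : ∀ w ∈ E, E.count w = 2) : I.Nodup ∧ ∀ w ∈ I, w ∉ M := by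
  subst hE
  have key : ∀ w ∈ I, M.count w + (I.count w + I.count w) = 2 := fun w hw => by
    simpa using h w (by simp [hw])
  refine ⟨Multiset.nodup_iff_count_le_one.2 fun w => ?_, fun w hw hM => ?_⟩
  · by_cases hw : w ∈ I
    · have := key w hw
      omega
    · simp [Multiset.count_eq_zero_of_notMem hw]
  · have := key w hw
    have := Multiset.count_pos.2 hw
    have := Multiset.count_pos.2 hM
    omega

theorem toFinset_val_add_internal {M I : Multiset ℕ} (hI : I.Nodup) (hM : ∀ w ∈ I, w ∉ M) :
    (M + (I + I)).toFinset.val = M.toFinset.val + I := by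
  refine (Multiset.Nodup.ext (Finset.nodup _) ?_).2 fun w => by simp
  exact Multiset.nodup_add.2 ⟨Finset.nodup _, hI,
    Multiset.disjoint_left.2 fun hw hw' => hM _ hw' (by simpa using hw)⟩

/-- The internal wires of a subdiagram can be summed first. -/
theorem denote_add (ins outs : List ℕ) (L C : Multiset (Vertex 𝒱)) (O I : Multiset ℕ)
    (hL : L.bind Vertex.legs = O + (I + I)) (hI : I.Nodup)
    (hM : ∀ w ∈ I, w ∉ (ins : Multiset ℕ) + outs + C.bind Vertex.legs + O)
    (v : 𝒱 → Bool) (x y : List Bool) :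
    (PreDiagram.instantiate v ⟨ins, outs, L + C⟩).denote x y =
      sumWires ((ins : Multiset ℕ) + outs + C.bind Vertex.legs + O).toFinset.val
        (fun b => boundary ins outs x y b * amplitude v C b * sumWires I (amplitude v L) b)
        fun _ => false := by
  have hE : PreDiagram.ends ⟨ins, outs, L + C⟩ =
      (ins : Multiset ℕ) + outs + C.bind Vertex.legs + O + (I + I) := by
    simp only [PreDiagram.ends, Multiset.add_bind, hL]
    abel
  have hG : DependsOn (fun b => boundary ins outs x y b * amplitude v C b) {w | w ∉ I} :=
    fun b b' h => by
      dsimp only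
      rw [boundary_dependsOn ins outs x y fun w hw => h w fun hI => hM w hI ?_,
        amplitude_dependsOn v C fun w hw => h w fun hI => hM w hI ?_]
      · exact Multiset.mem_add.2 (Or.inl (Multiset.mem_add.2 (Or.inr hw)))
      · simpa [or_assoc] using Or.inl hw
  rw [denote_instantiate, hE, toFinset_val_add_internal hI hM, sumWires_add]
  congr 1
  funext b
  rw [← sumWires_mul_left hG]
  congr 1
  funext b
  rw [amplitude_add]
  ring

/-- Once the internal wires are summed, both sides are sums over the same set of wires, those of the
context and of `O`, and the integrands differ by `k v`. The two-ends condition is needed on both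
sides, for `I` and for `J`. -/
theorem Proportional.of_soundRule {ins outs : List ℕ} {L R C : Multiset (Vertex 𝒱)}
    (h : SoundRule L R)
    (hL : ∀ w ∈ PreDiagram.ends ⟨ins, outs, L + C⟩,
      (PreDiagram.ends ⟨ins, outs, L + C⟩).count w = 2)
    (hR : ∀ w ∈ PreDiagram.ends ⟨ins, outs, R + C⟩,
      (PreDiagram.ends ⟨ins, outs, R + C⟩).count w = 2) :
    Proportional ⟨ins, outs, L + C⟩ ⟨ins, outs, R + C⟩ := by
  obtain ⟨O, I, J, hLO, hRO, h⟩ := h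
  have hE : ∀ {V : Multiset (Vertex 𝒱)} {I : Multiset ℕ}, V.bind Vertex.legs = O + (I + I) →
      PreDiagram.ends ⟨ins, outs, V + C⟩ =
        (ins : Multiset ℕ) + outs + C.bind Vertex.legs + O + (I + I) := fun hV => by
    simp only [PreDiagram.ends, Multiset.add_bind, hV]
    abel
  obtain ⟨hI, hIM⟩ := internal_of_two_ends (hE hLO) hL
  obtain ⟨hJ, hJM⟩ := internal_of_two_ends (hE hRO) hR
  obtain ⟨k, r, hr, hk, h⟩ := h hI (fun w hw h' => hIM w hw (Multiset.mem_add.2 (Or.inr h'))) hJ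
    fun w hw h' => hJM w hw (Multiset.mem_add.2 (Or.inr h'))
  refine ⟨k, r, hr, hk, fun v x y => ?_⟩
  rw [denote_add ins outs L C O I hLO hI hIM, denote_add ins outs R C O J hRO hJ hJM,
    ← sumWires_const_mul]
  congr 1
  funext b
  rw [h]
  ring

/-! ### Renaming and joining wires -/

theorem boundary_rename (ins outs : List ℕ) (f : ℕ → ℕ) (x y : List Bool) (b : ℕ → Bool) :
    boundary (ins.map f) (outs.map f) x y b = boundary ins outs x y (b ∘ f) := by
  simp [boundary]

theorem comp_joinWire (a k : ℕ) (b : ℕ → Bool) :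
    b ∘ joinWire a k = Function.update b k (b a) := by
  funext w
  by_cases hw : w = k <;> simp [joinWire, hw]

/-- Identify the wires `a` and `k` in a sum. -/
theorem sumWires_join {S : Finset ℕ} {a k : ℕ} (hak : a ≠ k) (hk : k ∈ S)
    (G : (ℕ → Bool) → ℂ) :
    sumWires S.val (fun b => (if b a = b k then 1 else 0) * G b) =
      sumWires (S.erase k).val fun b => G (b ∘ joinWire a k) := by
  have hS : S.val = (S.erase k).val + {k} := by
    rw [add_comm, Multiset.singleton_add, Finset.erase_val, Multiset.cons_erase hk]
  rw [hS, sumWires_add, sumWires_singleton]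
  congr 1
  funext b
  rw [comp_joinWire]
  cases h : b a <;> simp [sumWire, hak, h]

/-- The hypothesis `k ∈ M` guarantees that `a` occurs after the renaming, even when it did not occur
in `M`. -/
theorem toFinset_map_joinWire {M : Multiset ℕ} {a k : ℕ} (hak : a ≠ k) (hk : k ∈ M) :
    (M.map (joinWire a k)).toFinset = (M + {a, k}).toFinset.erase k := by
  ext w
  simp only [Multiset.mem_toFinset, Multiset.mem_map, Finset.mem_erase, Multiset.mem_add,
    Multiset.insert_eq_cons, Multiset.mem_cons, Multiset.mem_singleton]
  constructor
  · rintro ⟨z, hz, rfl⟩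
    by_cases h : z = k <;> simp [joinWire, h, hak, hz]
  · rintro ⟨hw, h | h | h⟩
    · exact ⟨w, h, by simp [joinWire, hw]⟩
    · exact ⟨k, hk, by simp [joinWire, h]⟩
    · exact absurd h hw

/-- A subdiagram which denotes the identity can be replaced with a wire. -/
theorem Proportional.of_wire {ins outs : List ℕ} {L C : Multiset (Vertex 𝒱)} {a b : ℕ}
    {I : Multiset ℕ} (hab : a ≠ b) (hL : L.bind Vertex.legs = {a, b} + (I + I))
    (h2 : ∀ w ∈ PreDiagram.ends ⟨ins, outs, L + C⟩,
      (PreDiagram.ends ⟨ins, outs, L + C⟩).count w = 2)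
    (h : I.Nodup → (∀ w ∈ I, w ∉ ({a, b} : Multiset ℕ)) → ∀ v x,
      sumWires I (amplitude v L) x = if x a = x b then 1 else 0) :
    Proportional ⟨ins, outs, L + C⟩ (PreDiagram.rename (joinWire a b) ⟨ins, outs, C⟩) := by
  have hE : PreDiagram.ends ⟨ins, outs, L + C⟩ =
      (ins : Multiset ℕ) + outs + C.bind Vertex.legs + {a, b} + (I + I) := by
    simp only [PreDiagram.ends, Multiset.add_bind, hL]
    abel
  obtain ⟨hI, hIM⟩ := internal_of_two_ends hE h2
  have h' := h hI fun w hw h' => hIM w hw (Multiset.mem_add.2 (Or.inr h'))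
  -- The removed piece holds only one of the two ends of `b`, so the other one lies in the rest of
  -- the diagram.
  have hb : b ∈ PreDiagram.ends ⟨ins, outs, C⟩ := by
    have h1 := h2 b (by simp [hE])
    have h3 : b ∉ I := fun hb => hIM b hb (by simp)
    rw [hE] at h1
    simp only [Multiset.count_add, Multiset.count_eq_zero_of_notMem h3, Multiset.insert_eq_cons,
      Multiset.count_cons_of_ne hab.symm, Multiset.count_singleton_self] at h1
    rw [← Multiset.count_pos, PreDiagram.ends]
    simp only [Multiset.count_add]
    omega
  refine Proportional.of_eq fun v x y => ?_
  rw [denote_add ins outs L C _ I hL hI hIM, denote_instantiate, ends_rename,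
    toFinset_map_joinWire hab hb]
  simp only [h', PreDiagram.rename, boundary_rename, amplitude_rename]
  have hb' : b ∈ (PreDiagram.ends (𝒱 := 𝒱) ⟨ins, outs, C⟩ + {a, b}).toFinset := by simp
  rw [← sumWires_join hab hb' fun x' => boundary ins outs x y x' * amplitude v C x']
  congr 1
  funext b
  ring

theorem hadamardEntry_mul (y z : Bool) :
    hadamardEntry y false * hadamardEntry false z + hadamardEntry y true * hadamardEntry true z =
      if y = z then 1 else 0 := by
  have := inv_sqrt_two_sq
  cases y <;> cases z <;> simp [hadamardEntry]
  all_goals grind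

theorem Proportional.of_rename_perm (D : PreDiagram 𝒱) (f : Equiv.Perm ℕ) :
    Proportional D (D.rename f) := by
  refine Proportional.of_eq fun v x y => ?_
  have hE : (D.ends.map f).toFinset.val = D.ends.toFinset.val.map f := by
    rw [Multiset.toFinset_val, Multiset.toFinset_val, Multiset.dedup_map_of_injective f.injective]
  rw [denote_instantiate, denote_instantiate, ends_rename, hE, sumWires_map_perm]
  simp only [PreDiagram.rename, boundary_rename, amplitude_rename, Function.comp_assoc,
    Equiv.symm_comp_self, Function.comp_id]
  -- Precomposing the all-`false` assignment with `f` does not change it.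
  rfl

theorem Step.proportional {D D' : PreDiagram 𝒱} (h : Step D D')
    (hD : ∀ w ∈ D.ends, D.ends.count w = 2) (hD' : ∀ w ∈ D'.ends, D'.ends.count w = 2) :
    Proportional D D' := by
  cases h with
  | replace ins outs L R C h => exact .of_soundRule h.soundRule hD hD'
  | identity ins outs c a b hab C =>
    rw [← Multiset.singleton_add] at hD ⊢
    refine .of_wire (I := 0) hab (by simp [Vertex.legs]) hD fun _ _ v x => ?_
    rw [sumWires_zero, amplitude_singleton, weight_spider_zero, spiderWeight_pair, twoLegs_one]
  | hCancel ins outs a k b hab C =>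
    have hC : Vertex.hadamard {a, k} ::ₘ Vertex.hadamard {k, b} ::ₘ C =
        {Vertex.hadamard {a, k}, Vertex.hadamard {k, b}} + C := by simp
    rw [hC] at hD ⊢
    refine .of_wire (I := {k}) hab ?_ hD fun _ hI v x => ?_
    · simp only [Multiset.insert_eq_cons, Multiset.cons_bind, Multiset.singleton_bind, Vertex.legs]
      simp only [← Multiset.singleton_add]
      abel
    · have hk : k ≠ a ∧ k ≠ b := by simpa using hI k (by simp)
      simp only [Multiset.insert_eq_cons, sumWires_singleton, sumWire, amplitude_cons,
        amplitude_singleton]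
      simp only [← Multiset.insert_eq_cons, weight_hadamard, Function.update_self,
        Function.update_of_ne hk.1.symm, Function.update_of_ne hk.2.symm, hadamardEntry_mul]
  | iso => exact .of_rename_perm _ _

/-- Rewriting preserves the interpretation, up to a factor whose modulus does not depend on the
valuation. -/
theorem Rewrites.proportional {D D' : Diagram 𝒱} (h : Rewrites D D') :
    Proportional D.toPreDiagram D'.toPreDiagram := by
  induction h with
  | rel D D' h => exact h.proportional D.two_ends D'.two_ends
  | refl D => exact .of_eq fun _ _ _ => rfl
  | symm D D' _ ih => exact ih.symm
  | trans D D' D'' _ _ ih ih' => exact ih.trans ih'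

/-- The instances of an unconditional diagram coincide. -/
theorem Diagram.Unconditional.instantiate_eq {D : Diagram 𝒱} (h : D.Unconditional)
    (v w : 𝒱 → Bool) : D.toPreDiagram.instantiate v = D.toPreDiagram.instantiate w := by
  rw [PreDiagram.instantiate, PreDiagram.instantiate]
  congr 1
  refine Multiset.map_congr rfl fun x hx => ?_
  have hU := h x hx
  cases x with
  | spider c α U A =>
    obtain rfl : U = ∅ := hU
    simp [Vertex.instantiate, angleAt, Active]
  | hadamard A => rfl

end

/-! ### The diagram of a pattern computes its branch maps -/

section

variable {Q : Type u}

/-- The convention that an empty label is active matches the convention that a correction without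
control is always applied. -/
theorem active_controlLabel (v : Q → Bool) (s : Option Q) :
    Active v (controlLabel s) ↔ controlValue v s = true := by
  cases s <;> simp [Active, controlLabel, controlValue]

theorem expI_angleAt_controlLabel (v : Q → Bool) (s : Option Q) :
    expI (angleAt v (Real.pi : ℝ) (controlLabel s)) = if controlValue v s then -1 else 1 := by
  classical
  rw [expI_angleAt_pi]
  simp only [active_controlLabel]

theorem sumWires_const (I : Multiset ℕ) (k : ℂ) (b : ℕ → Bool) :
    sumWires I (fun _ => k) b = 2 ^ I.card * k := by
  induction I using Multiset.induction_on generalizing b with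
  | empty => simp
  | cons w I ih =>
    simp only [sumWires_cons, sumWire, ih, Multiset.card_cons]
    ring

/-- The indicator of the event that the wires of the qubits in `A` carry the basis state `x`. -/
noncomputable def registerIndicator (wire : Q → ℕ) (A : Finset Q) (x : Q → Bool) (b : ℕ → Bool) :
    ℂ :=
  ∏ q ∈ A, if b (wire q) = x q then 1 else 0

/-- The amplitude of the state `x` of the register `A` in a partial translation, when the inputs
carry the state `a`. -/
noncomputable def Partial.registerSum (t : Partial Q) (ins : List ℕ) (A : Finset Q)
    (v : Q → Bool) (a : List Bool) (x : Q → Bool) : ℂ :=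
  sumWires (Multiset.range t.next) (fun b => (if ins.map b = a then 1 else 0) *
    (registerIndicator t.wire A x b * amplitude v t.vertices b)) fun _ => false

/-- Appending vertices to a partial translation, at the wires of the qubits in `M`. -/
theorem Partial.registerSum_append [DecidableEq Q] {t t' : Partial Q} {ins : List ℕ}
    {K M M' : Finset Q} {V : Multiset (Vertex Q)} {N : Multiset ℕ}
    (hV : t'.vertices = V + t.vertices)
    (hN : Multiset.range t'.next = Multiset.range t.next + N) (hw : ∀ q ∈ K, t'.wire q = t.wire q)
    (hKM : Disjoint K M) (hKM' : Disjoint K M') (hNn : ∀ w ∈ N, t.next ≤ w)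
    (hP : ∀ w ∈ t.ends ins (K ∪ M).val, w < t.next)
    {v x x₀ x₁ : Q → Bool} (hx₀ : ∀ q ∈ K, x₀ q = x q) (hx₁ : ∀ q ∈ K, x₁ q = x q) {k₀ k₁ : ℂ}
    (h : ∀ b, sumWires N (fun b => registerIndicator t'.wire M' x b * amplitude v V b) b =
      k₀ * registerIndicator t.wire M x₀ b + k₁ * registerIndicator t.wire M x₁ b)
    (a : List Bool) :
    t'.registerSum ins (K ∪ M') v a x =
      k₀ * t.registerSum ins (K ∪ M) v a x₀ + k₁ * t.registerSum ins (K ∪ M) v a x₁ := by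
  have hK : ∀ y : Q → Bool, (∀ q ∈ K, y q = x q) →
      registerIndicator t.wire K y = registerIndicator t.wire K x := fun y hy => by
    funext b
    exact Finset.prod_congr rfl fun q hq => by rw [hy q hq]
  have hK' : registerIndicator t'.wire K x = registerIndicator t.wire K x := by
    funext b
    exact Finset.prod_congr rfl fun q hq => by rw [hw q hq]
  have hU : ∀ (w : Q → ℕ) (A : Finset Q) (y : Q → Bool) (b : ℕ → Bool), Disjoint K A →
      registerIndicator w (K ∪ A) y b = registerIndicator w K y b * registerIndicator w A y b :=
    fun w A y b hA => Finset.prod_union hA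
  -- The new wires are numbered from `t.next` on, so no factor of the old translation sees them.
  have hlt : ∀ w, w < t.next → w ∉ N := fun w hw h' => absurd (hNn w h') (not_le.2 hw)
  have hG : DependsOn (fun b => (if ins.map b = a then (1 : ℂ) else 0) *
      (registerIndicator t.wire K x b * amplitude v t.vertices b)) {w | w ∉ N} := fun b b' hb => by
    have h1 : ins.map b = ins.map b' := List.map_congr_left fun w hw =>
      hb w (hlt w (hP w (by simp [Partial.ends, hw])))
    have h2 : registerIndicator t.wire K x b = registerIndicator t.wire K x b' :=
      Finset.prod_congr rfl fun q hq => by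
        rw [hb (t.wire q) (hlt _ (hP _ ?_))]
        simp only [Partial.ends, Multiset.mem_add]
        exact Or.inl (Or.inr (Multiset.mem_map_of_mem _ (Finset.mem_union_left M hq)))
    have h3 : amplitude v t.vertices b = amplitude v t.vertices b' :=
      amplitude_dependsOn v _ fun w hw => hb w (hlt w (hP w (Multiset.mem_add.2 (Or.inr hw))))
    dsimp only
    rw [h1, h2, h3]
  -- The new wires are summed first, where `h` evaluates the new vertices. Only a measurement uses
  -- both terms of `h`; the other commands take `k₁ = 0`.
  have hsum : t'.registerSum ins (K ∪ M') v a x =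
      sumWires (Multiset.range t.next) (fun b => ((if ins.map b = a then (1 : ℂ) else 0) *
        (registerIndicator t.wire K x b * amplitude v t.vertices b)) *
        (k₀ * registerIndicator t.wire M x₀ b + k₁ * registerIndicator t.wire M x₁ b))
        fun _ => false := by
    rw [Partial.registerSum, hN, sumWires_add]
    congr 1
    funext b
    rw [← h, ← sumWires_mul_left hG]
    congr 1
    funext b
    rw [hV, amplitude_add, hU _ _ _ _ hKM', hK']
    ring
  rw [hsum, Partial.registerSum, Partial.registerSum, ← sumWires_const_mul, ← sumWires_const_mul,
    ← sumWires_fun_add]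
  congr 1
  funext b
  rw [hU _ _ _ _ hKM, hU _ _ _ _ hKM, hK _ hx₀, hK _ hx₁]
  ring

theorem range_succ_eq (n : ℕ) : Multiset.range (n + 1) = Multiset.range n + {n} := by
  rw [Multiset.range_succ, add_comm, Multiset.singleton_add]

theorem lt_next_of_paired {t : Partial Q} {ins : List ℕ} {A : Finset Q}
    (h : Pattern.Paired (t.ends ins A.val) t.next) {q : Q} (hq : q ∈ A) : t.wire q < t.next :=
  h.2 _ (by
    simp only [Partial.ends, Multiset.mem_add]
    exact Or.inl (Or.inr (Multiset.mem_map_of_mem _ hq)))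

end

namespace Pattern

variable {Q : Type u}

/-! ### The effect of one command on the register -/

section

variable [DecidableEq Q]

/-- The leaf is `|0⟩ + |1⟩`, which gives either bit of the new qubit the coefficient `1`. -/
theorem registerSum_prepare {t : Partial Q} {ins : List ℕ} {A : Finset Q}
    (h : Paired (t.ends ins A.val) t.next) {i : Q} (hi : i ∉ A) (v : Q → Bool) (a : List Bool)
    (x : Q → Bool) :
    (t.append (.prepare i)).registerSum ins (insert i A) v a x = t.registerSum ins A v a x := by
  have key := Partial.registerSum_append (t := t) (t' := t.append (.prepare i)) (ins := ins)
    (K := A) (M := ∅) (M' := {i}) (V := {.spider .Z 0 ∅ {t.next}}) (N := {t.next}) (v := v)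
    (x := x) (x₀ := x) (x₁ := x) (k₀ := 1) (k₁ := 0) rfl (range_succ_eq _)
    (fun q hq => Function.update_of_ne (fun e : q = i => hi (e ▸ hq)) _ _) (by simp) (by simpa using hi)
    (by simp) (by simpa using h.2) (fun _ _ => rfl) (fun _ _ => rfl) ?_ a
  · rw [Finset.union_empty, Finset.union_comm, ← Finset.insert_eq] at key
    rw [key]
    ring
  · intro b
    cases hx : x i <;> simp [registerIndicator, Partial.append, sumWire, amplitude_singleton,
      weight_spider_zero, spiderWeight, basisVec, hx]

/-- The conditional π gives the sign of the outcome on `|1⟩` and the final vertex gives `e^{-iα}`: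
together they are `√2 ⟨±_α|`. The bit of `i` is summed out, and its two values give the two terms.
-/
theorem registerSum_measure {t : Partial Q} {ins : List ℕ} {A : Finset Q}
    (h : Paired (t.ends ins A.val) t.next) {i : Q} (hi : i ∈ A) (α : Real.Angle) (v : Q → Bool)
    (a : List Bool) (x : Q → Bool) :
    (t.append (.measure i α)).registerSum ins (A.erase i) v a x =
      t.registerSum ins A v a (Function.update x i false) +
        (if v i then -1 else 1) * expI (-α) * t.registerSum ins A v a (Function.update x i true) := by
  have hA : A.erase i ∪ {i} = A := by
    rw [Finset.union_comm, ← Finset.insert_eq, Finset.insert_erase hi]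
  have hne : t.wire i ≠ t.next := (lt_next_of_paired h hi).ne
  have hu : ∀ z, ∀ q ∈ A.erase i, Function.update x i z q = x q := fun z q hq =>
    Function.update_of_ne (Finset.ne_of_mem_erase hq) _ _
  have key := Partial.registerSum_append (t := t) (t' := t.append (.measure i α)) (ins := ins)
    (K := A.erase i) (M := {i}) (M' := ∅)
    (V := {.spider .Z (Real.pi : ℝ) {i} {t.wire i, t.next}, .spider .Z (-α) ∅ {t.next}})
    (N := {t.next}) (v := v) (x := x) (k₀ := 1) (k₁ := (if v i then -1 else 1) * expI (-α))
    (by simp [Partial.append]) (range_succ_eq _) (fun _ _ => rfl) (by simp) (by simp)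
    (by simp) (by rw [hA]; exact h.2) (hu false) (hu true) ?_ a
  · rw [hA, Finset.union_empty, one_mul] at key
    exact key
  · intro b
    have he : expI (angleAt v (Real.pi : ℝ) {i}) = if v i then -1 else 1 :=
      expI_angleAt_controlLabel v (some i)
    simp only [Multiset.insert_eq_cons, sumWires_singleton, sumWire, amplitude_cons,
      amplitude_singleton]
    simp only [← Multiset.insert_eq_cons, weight_spider, spiderWeight_pair, Function.update_self,
      Function.update_of_ne hne, he]
    cases hb : b (t.wire i) <;> by_cases hvi : v i = true <;>
      simp [registerIndicator, spiderWeight, twoLegs, basisVec, angleAt, Active, hb]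

/-- A Pauli matrix has one non-zero entry in each row, so a given final bit comes from the single
earlier bit `x₀ i`, with coefficient `k`. This treats both kinds of correction at once. -/
theorem registerSum_correct {t t' : Partial Q} {ins : List ℕ} {A : Finset Q}
    (h : Paired (t.ends ins A.val) t.next) {i : Q} (hi : i ∈ A) {s : Option Q} {c : Colour}
    (ht' : t' = ⟨.spider c (Real.pi : ℝ) (controlLabel s) {t.wire i, t.next} ::ₘ t.vertices,
      Function.update t.wire i t.next, t.next + 1⟩) {v x x₀ : Q → Bool}
    (hx₀ : ∀ q, q ≠ i → x₀ q = x q) {k : ℂ}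
    (hk : ∀ y, twoLegs c (if controlValue v s then -1 else 1) y (x i) =
      k * if y = x₀ i then 1 else 0) (a : List Bool) :
    t'.registerSum ins A v a x = k * t.registerSum ins A v a x₀ := by
  subst ht'
  have hA : A.erase i ∪ {i} = A := by
    rw [Finset.union_comm, ← Finset.insert_eq, Finset.insert_erase hi]
  have hne : t.wire i ≠ t.next := (lt_next_of_paired h hi).ne
  have hu : ∀ q ∈ A.erase i, x₀ q = x q := fun q hq => hx₀ q (Finset.ne_of_mem_erase hq)
  have key := Partial.registerSum_append (t := t) (t' :=
    ⟨.spider c (Real.pi : ℝ) (controlLabel s) {t.wire i, t.next} ::ₘ t.vertices,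
      Function.update t.wire i t.next, t.next + 1⟩) (ins := ins)
    (K := A.erase i) (M := {i}) (M' := {i})
    (V := {.spider c (Real.pi : ℝ) (controlLabel s) {t.wire i, t.next}})
    (N := {t.next}) (v := v) (x := x) (k₀ := k) (k₁ := 0)
    (by simp) (range_succ_eq _)
    (fun q hq => Function.update_of_ne (Finset.ne_of_mem_erase hq) _ _) (by simp) (by simp)
    (by simp) (by rw [hA]; exact h.2) hu hu ?_ a
  · rw [hA] at key
    rw [key]
    ring
  · intro b
    simp only [sumWires_singleton, sumWire, amplitude_singleton, weight_spider, spiderWeight_pair,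
      Function.update_self, Function.update_of_ne hne, expI_angleAt_controlLabel, registerIndicator,
      Finset.prod_singleton]
    rw [← hk]
    cases x i <;> simp

/-- The `Z` vertices copy the bits of `i` and `j` to the Hadamard vertex, whose entry is that of
`∧Z` divided by `√2`. -/
theorem registerSum_entangle {t : Partial Q} {ins : List ℕ} {A : Finset Q}
    (h : Paired (t.ends ins A.val) t.next) {i j : Q} (hij : i ≠ j) (hi : i ∈ A) (hj : j ∈ A)
    (v : Q → Bool) (a : List Bool) (x : Q → Bool) :
    (t.append (.entangle i j)).registerSum ins A v a x =
      hadamardEntry (x i) (x j) * t.registerSum ins A v a x := by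
  have hA : A \ {i, j} ∪ {i, j} = A :=
    Finset.sdiff_union_of_subset (by simp [Finset.insert_subset_iff, hi, hj])
  have hni := lt_next_of_paired h hi
  have hnj := lt_next_of_paired h hj
  have hN : Multiset.range (t.next + 4) = Multiset.range t.next +
      {t.next, t.next + 1, t.next + 2, t.next + 3} := by
    simp only [Multiset.insert_eq_cons, ← Multiset.singleton_add, range_succ_eq, add_assoc]
  have key := Partial.registerSum_append (t := t) (t' := t.append (.entangle i j)) (ins := ins)
    (K := A \ {i, j}) (M := {i, j}) (M' := {i, j})
    (V := {.spider .Z 0 ∅ {t.wire i, t.next, t.next + 2},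
      .spider .Z 0 ∅ {t.wire j, t.next + 1, t.next + 3}, .hadamard {t.next + 2, t.next + 3}})
    (N := {t.next, t.next + 1, t.next + 2, t.next + 3}) (v := v) (x := x) (x₀ := x) (x₁ := x)
    (k₀ := hadamardEntry (x i) (x j)) (k₁ := 0)
    (by simp [Partial.append]) hN
    (fun q hq => by
      have hq' : q ≠ i ∧ q ≠ j := by simpa using (Finset.mem_sdiff.1 hq).2
      simp [Partial.append, hq'.1, hq'.2]) Finset.sdiff_disjoint Finset.sdiff_disjoint
    (by simp) (by rw [hA]; exact h.2) (fun _ _ => rfl) (fun _ _ => rfl) ?_ a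
  · rw [hA] at key
    rw [key]
    ring
  · intro b
    have hni' : ∀ k, t.wire i ≠ t.next + k := fun k => by omega
    have hnj' : ∀ k, t.wire j ≠ t.next + k := fun k => by omega
    simp only [Multiset.insert_eq_cons, sumWires_cons, sumWires_singleton, sumWire, amplitude_cons,
      amplitude_singleton]
    simp only [← Multiset.insert_eq_cons, weight_spider_zero, weight_hadamard,
      spiderWeight_triple, registerIndicator, Finset.prod_pair hij, Partial.append]
    cases hxi : x i <;> cases hxj : x j <;> cases hbi : b (t.wire i) <;>
      cases hbj : b (t.wire j) <;>
      simp [hij, hni', hnj', hni.ne, hnj.ne, hbi, hbj, threeLegs]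

end

/-! ### From register sums to branch maps -/

section

variable [LinearOrder Q]

/-- A state of a register, given by bits for its qubits, as a function on all qubits. -/
noncomputable def extendBits {A : Finset Q} (y : A → Bool) (q : Q) : Bool :=
  if h : q ∈ A then y ⟨q, h⟩ else false

theorem map_sort_eq_iff (A : Finset Q) (wire : Q → ℕ) (x : Q → Bool) (b : ℕ → Bool) :
    ((A.sort (· ≤ ·)).map wire).map b = (A.sort (· ≤ ·)).map x ↔ ∀ q ∈ A, b (wire q) = x q := by
  rw [List.map_map, List.map_inj_left]
  simp

theorem registerIndicator_eq_ite (A : Finset Q) (wire : Q → ℕ) (x : Q → Bool) (b : ℕ → Bool) :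
    registerIndicator wire A x b =
      if ((A.sort (· ≤ ·)).map wire).map b = (A.sort (· ≤ ·)).map x then 1 else 0 := by
  simp only [map_sort_eq_iff, registerIndicator, Finset.prod_ite_zero, Finset.prod_const_one]

end

variable [Fintype Q] [LinearOrder Q]

/-- If the sums of a partial translation are the amplitudes of a state, up to a positive factor,
this remains so when a command is translated and executed. -/
theorem exists_registerSum_append (P : Pattern Q) {ι : Type*} {ins : List ℕ} {t : Partial Q}
    {pre post : List (Command Q)} {c : Command Q} (h : P.commands = pre ++ c :: post)
    (ht : Paired (t.ends ins (P.live pre).val) t.next) {a : ι → List Bool}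
    {ψ : (Q → Bool) → ι → (Q → Bool) → ℂ} {r : ℝ} (hr : 0 < r)
    (hψ : ∀ v k x, t.registerSum ins (P.live pre) v (a k) x = r * ψ v k x) :
    ∃ r' : ℝ, 0 < r' ∧ ∀ v k x, (t.append c).registerSum ins (P.live (pre ++ [c])) v (a k) x =
      r' * c.run v (ψ v k) x := by
  have h2 : 0 < Real.sqrt 2 := by positivity
  cases c with
  | prepare i =>
    obtain ⟨hi, hl⟩ := P.live_append_prepare h
    -- The leaf in the diagram lacks the normalisation `1/√2` of `|+⟩`.
    refine ⟨r * Real.sqrt 2, mul_pos hr h2, fun v k x => ?_⟩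
    rw [hl, registerSum_prepare ht hi, hψ, Command.run, Complex.ofReal_mul]
    field_simp
  | measure i α =>
    have hi : i ∈ P.live pre := P.mem_live_of_actsOn h rfl (by simp)
    refine ⟨r * Real.sqrt 2, mul_pos hr h2, fun v k x => ?_⟩
    rw [live_append_measure, registerSum_measure ht hi, hψ, hψ, Command.run, Complex.ofReal_mul]
    field_simp
  | correctX i s =>
    have hi : i ∈ P.live pre := P.mem_live_of_actsOn h rfl (by simp)
    refine ⟨r, hr, fun v k x => ?_⟩
    rw [live_append_other _ _ _ (by simp) (by simp), registerSum_correct (c := .X)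
      (t' := t.append (.correctX i s)) ht hi rfl
      -- The amplitude at `x` after a flip is the amplitude before it at the flipped bit.
      (x₀ := if controlValue v s then Function.update x i (!x i) else x) (k := 1), hψ, one_mul,
      Command.run]
    · cases controlValue v s <;> rfl
    · intro q hq
      cases controlValue v s <;> simp [hq]
    · intro y
      cases controlValue v s
      · simp [twoLegs_one]
      · cases y <;> cases x i <;> simp [twoLegs_neg_one]
  | correctZ i s =>
    have hi : i ∈ P.live pre := P.mem_live_of_actsOn h rfl (by simp)
    refine ⟨r, hr, fun v k x => ?_⟩
    rw [live_append_other _ _ _ (by simp) (by simp), registerSum_correct (c := .Z)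
      (t' := t.append (.correctZ i s)) ht hi rfl
      (x₀ := x) (k := if controlValue v s && x i then -1 else 1) (fun _ _ => rfl), hψ, Command.run]
    · dsimp only
      split_ifs <;> ring
    · intro y
      cases controlValue v s
      · simp [twoLegs_one]
      · cases y <;> cases x i <;> simp [twoLegs_neg_one]
  | entangle i j =>
    have hij : i ≠ j := P.entangle_ne i j (by simp [h])
    have hi : i ∈ P.live pre := P.mem_live_of_actsOn h (Or.inl rfl) (by simp)
    have hj : j ∈ P.live pre := P.mem_live_of_actsOn h (Or.inr rfl) (by simp)
    -- The Hadamard vertex carries a `1/√2` that `∧Z` does not have.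
    refine ⟨r / Real.sqrt 2, div_pos hr h2, fun v k x => ?_⟩
    rw [live_append_other _ _ _ (by simp) (by simp), registerSum_entangle ht hij hi hj, hψ,
      Command.run, hadamardEntry, Complex.ofReal_div]
    dsimp only
    split_ifs <;> ring

/-- The states for all outcomes `v` and all inputs `k` are carried through the induction together,
so that one factor `r'` serves them all. A factor that varied with `v` would be useless for
comparing branches. -/
theorem exists_registerSum_foldl (P : Pattern Q) {ι : Type*} {ins : List ℕ}
    (post pre : List (Command Q)) (t : Partial Q) (h : P.commands = pre ++ post)
    (ht : Paired (t.ends ins (P.live pre).val) t.next) (hv : ∀ x ∈ t.vertices, x.Admissible)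
    {a : ι → List Bool} (ψ : (Q → Bool) → ι → (Q → Bool) → ℂ) (r : ℝ) (hr : 0 < r)
    (hψ : ∀ v k x, t.registerSum ins (P.live pre) v (a k) x = r * ψ v k x) :
    Paired ((post.foldl Partial.append t).ends ins P.outputs.val)
        (post.foldl Partial.append t).next ∧
      ∃ r' : ℝ, 0 < r' ∧ ∀ v k x,
        (post.foldl Partial.append t).registerSum ins P.outputs v (a k) x =
          r' * post.foldl (fun ψ c => c.run v ψ) (ψ v k) x := by
  induction post generalizing pre t ψ r with
  | nil =>
    have hl : P.live pre = P.outputs := by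
      rw [← live_commands, h, List.append_nil]
    rw [hl] at ht hψ
    exact ⟨ht, r, hr, hψ⟩
  | cons c post ih =>
    obtain ⟨h1, h2⟩ := P.paired_append ins t c h ht hv
    obtain ⟨r', hr', h'⟩ := P.exists_registerSum_append h ht hr hψ
    exact ih (pre ++ [c]) (t.append c) (by simp [h]) h1 h2 (fun v k => c.run v (ψ v k)) r' hr' h'

theorem range_next_initialPartial (P : Pattern Q) :
    Multiset.range P.initialPartial.next = P.inputs.val.map P.initialPartial.wire := by
  refine (Multiset.eq_of_le_of_card_le ((Multiset.le_iff_subset ?_).2 fun w hw => ?_) ?_).symm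
  · refine Multiset.Nodup.map_on (fun q hq q' _ e => ?_) P.inputs.nodup
    exact (List.idxOf_inj ((Finset.mem_sort (· ≤ ·)).2 hq)).1 e
  · obtain ⟨q, hq, rfl⟩ := Multiset.mem_map.1 hw
    have := List.idxOf_lt_length_of_mem ((Finset.mem_sort (· ≤ ·)).2 hq)
    simpa [initialPartial] using this
  · simp [initialPartial]

/-- Before any command each input wire is compared both with the input `a` and with the register
state `x`; summing over its bit leaves a Kronecker delta. -/
theorem registerSum_initialPartial (P : Pattern Q) (v : Q → Bool) (a : P.inputs → Bool)
    (x : Q → Bool) :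
    P.initialPartial.registerSum P.preDiagram.inputs P.inputs v
      ((P.inputs.sort (· ≤ ·)).map (extendBits a)) x = P.inputState a x := by
  have hnd : (P.inputs.val.map P.initialPartial.wire).Nodup := by
    rw [← range_next_initialPartial]
    exact Multiset.nodup_range _
  have h := sumWires_prod P.inputs.val P.initialPartial.wire
    (fun q z _ => (if z = extendBits a q then (1 : ℂ) else 0) * if z = x q then 1 else 0) hnd
    (fun _ _ _ _ _ _ => rfl) fun _ => false
  have hF : (fun b => (if P.preDiagram.inputs.map b = (P.inputs.sort (· ≤ ·)).map (extendBits a)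
      then (1 : ℂ) else 0) * (registerIndicator P.initialPartial.wire P.inputs x b *
        amplitude v P.initialPartial.vertices b)) =
      fun b => (P.inputs.val.map fun q =>
        (if b (P.initialPartial.wire q) = extendBits a q then (1 : ℂ) else 0) *
          if b (P.initialPartial.wire q) = x q then 1 else 0).prod := by
    funext b
    have hin : (if P.preDiagram.inputs.map b = (P.inputs.sort (· ≤ ·)).map (extendBits a)
        then (1 : ℂ) else 0) = registerIndicator P.initialPartial.wire P.inputs (extendBits a) b :=
      (registerIndicator_eq_ite _ _ _ _).symm
    rw [hin, show P.initialPartial.vertices = 0 from rfl, amplitude_zero, mul_one,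
      registerIndicator, registerIndicator, ← Finset.prod_mul_distrib]
    rfl
  rw [Partial.registerSum, range_next_initialPartial, hF]
  refine h.trans ?_
  have hq : ∀ q, ((if false = extendBits a q then (1 : ℂ) else 0) * (if false = x q then 1 else 0) +
      (if true = extendBits a q then (1 : ℂ) else 0) * if true = x q then 1 else 0) =
      if x q = extendBits a q then 1 else 0 := fun q => by
    cases extendBits a q <;> cases x q <;> simp
  simp only [hq]
  refine (Finset.prod_ite_zero (s := P.inputs) (f := fun _ => (1 : ℂ))).trans ?_
  rw [Finset.prod_const_one, inputState]
  congr 1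
  refine propext ⟨fun h q => ?_, fun h q hq => ?_⟩
  · simpa [extendBits] using h q q.2
  · simpa [extendBits, hq] using h ⟨q, hq⟩

theorem branchMap_apply (P : Pattern Q) (v : Q → Bool) (y : P.outputs → Bool)
    (a : P.inputs → Bool) :
    P.branchMap v y a =
      P.commands.foldl (fun ψ c => c.run v ψ) (P.inputState a) (extendBits y) := by
  simp only [branchMap, Matrix.of_apply]
  -- The two extensions by `false` differ only in their decidability instances.
  congr!
  rw [extendBits]
  congr!

/-- The diagram of a pattern computes its branch maps, up to a positive factor. -/
theorem exists_denote_diagram (P : Pattern Q) :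
    ∃ r : ℝ, 0 < r ∧ ∀ (v : Q → Bool) (y : P.outputs → Bool) (a : P.inputs → Bool),
      (P.diagram.toPreDiagram.instantiate v).denote ((P.inputs.sort (· ≤ ·)).map (extendBits a))
        ((P.outputs.sort (· ≤ ·)).map (extendBits y)) = r * P.branchMap v y a := by
  obtain ⟨hP, r, hr, h⟩ := P.exists_registerSum_foldl P.commands [] P.initialPartial rfl
    P.paired_initial (by simp [initialPartial])
    (a := fun a : P.inputs → Bool => (P.inputs.sort (· ≤ ·)).map (extendBits a))
    (fun _ a => P.inputState a) 1 one_pos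
    (fun v a x => by rw [live_nil, registerSum_initialPartial, Complex.ofReal_one, one_mul])
  change Paired (P.finalPartial.ends _ _) P.finalPartial.next at hP
  change ∀ v k x, P.finalPartial.registerSum _ _ _ _ _ = _ at h
  have hends : P.preDiagram.ends = P.finalPartial.ends P.preDiagram.inputs P.outputs.val := by
    have hperm : ((P.outputs.sort (· ≤ ·) : List Q) : Multiset Q) = P.outputs.val := by simp
    rw [Partial.ends, ← hperm, Multiset.map_coe]
    rfl
  have hle : P.preDiagram.ends.toFinset.val ≤ Multiset.range P.finalPartial.next :=
    (Multiset.le_iff_subset (Finset.nodup _)).2 fun w hw =>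
      Multiset.mem_range.2 (hP.2 w (by simpa [hends] using hw))
  obtain ⟨N, hN⟩ := Multiset.le_iff_exists_add.1 hle
  -- The register sum runs over all numbers below `next`, the interpretation only over wires that
  -- occur. Each number in the difference `N` doubles the sum, so no proof that `N` is empty is
  -- required.
  refine ⟨r / 2 ^ N.card, by positivity, fun v y a => ?_⟩
  have h' := h v a (extendBits y)
  have hF : (fun b => (if P.preDiagram.inputs.map b = (P.inputs.sort (· ≤ ·)).map (extendBits a)
      then (1 : ℂ) else 0) * (registerIndicator P.finalPartial.wire P.outputs (extendBits y) b *
        amplitude v P.finalPartial.vertices b)) =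
      fun b => boundary P.preDiagram.inputs P.preDiagram.outputs
        ((P.inputs.sort (· ≤ ·)).map (extendBits a)) ((P.outputs.sort (· ≤ ·)).map (extendBits y)) b *
          amplitude v P.preDiagram.vertices b := by
    funext b
    rw [registerIndicator_eq_ite, boundary, ← mul_assoc, ite_and, ite_mul, one_mul, zero_mul]
    rfl
  have hD : ∀ b, sumWires P.preDiagram.ends.toFinset.val
      (fun b => boundary P.preDiagram.inputs P.preDiagram.outputs
        ((P.inputs.sort (· ≤ ·)).map (extendBits a)) ((P.outputs.sort (· ≤ ·)).map (extendBits y)) b *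
          amplitude v P.preDiagram.vertices b) b =
      (P.preDiagram.instantiate v).denote ((P.inputs.sort (· ≤ ·)).map (extendBits a))
        ((P.outputs.sort (· ≤ ·)).map (extendBits y)) := fun b => by
    rw [denote_instantiate]
    refine dependsOn_sumWires (s := ∅) (fun b b' hb => ?_) fun _ h' => absurd h' (Set.notMem_empty _)
    rw [boundary_dependsOn _ _ _ _ fun w hw => hb w (Or.inr ?_),
      amplitude_dependsOn v _ fun w hw => hb w (Or.inr ?_)]
    · exact Multiset.mem_toFinset.2 (Multiset.mem_add.2 (Or.inr hw))
    · refine Multiset.mem_toFinset.2 (Multiset.mem_add.2 (Or.inl ?_))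
      simpa using hw
  rw [Partial.registerSum, hF, hN, add_comm, sumWires_add, funext hD, sumWires_const,
    ← branchMap_apply] at h'
  change (P.preDiagram.instantiate v).denote _ _ = _
  have h2 : (2 : ℂ) ^ N.card ≠ 0 := by simp
  push_cast
  field_simp
  exact (mul_comm _ _).trans h'

end Pattern

end MBQC

/-! ### The main theorem -/

theorem mainTheorem5 {Q : Type*} [Fintype Q] [LinearOrder Q] (P : MBQC.Pattern Q)
    (h : ∃ D : MBQC.Diagram Q, D.Unconditional ∧ MBQC.Rewrites P.diagram D) :
    P.StronglyDeterministic := by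
  obtain ⟨D, hD, hP⟩ := h
  obtain ⟨k, r, hr, hk, h⟩ := hP.proportional
  obtain ⟨s, hs, hb⟩ := P.exists_denote_diagram
  intro v w
  have hk0 : k w ≠ 0 := norm_pos_iff.1 (by rw [hk]; exact hr)
  have hs0 : (s : ℂ) ≠ 0 := by simpa using hs.ne'
  -- Both scalars have modulus `r`, so the quotient is a phase.
  refine ⟨k v / k w, by rw [norm_div, hk, hk, div_self hr.ne'], ?_⟩
  ext y a
  have hv := hb v y a
  have hw := hb w y a
  -- Both branches are now expressed by the same instance of `D`, the one at `w`.
  rw [h, hD.instantiate_eq v w] at hv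
  rw [h] at hw
  rw [Matrix.smul_apply, smul_eq_mul]
  refine mul_left_cancel₀ hs0 ?_
  rw [← hv, mul_left_comm, ← hw]
  field_simp
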